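/- **Setting.** The plant is $x(t+1)=f(x(t),u(t))$ with $x(t)\in\mathbb R^{l_s}$, $u(t)\in\mathbb R^{l_u}$, $f$ measurable. A function $\phi:\mathbb R_{\ge0}\to\mathbb R_{\ge0}$ is called of class $\mathcal K_\infty$ if it is continuous, strictly increasing and $\phi(0)=0$. *Network.* $B(t)\in\{0,\dots,\bar B\}$ (quality of the controller–actuator channel), $B'(t)\in\{1,\dots,\bar B'\}$ (quality of the sensor–controller channel) and $N(t)\in\{0,\dots,\bar N\}$ (number of commands that can be computed) form a time-homogeneous Markov chain $(B,B',N)$ with transition matrix $Q$ that is irreducible and aperiodic and starts in a fixed state. Let $\gamma(t),\gamma'(t)\in\{0,1\}$ indicate success of the controller–actuator and the sensor–controller transmission at time $t$. Given the chain, these outcomes are independent of each other and over time, with drop probabilities $\bar\gamma\in(0,1]$ and $g(h_{B'(t)})\in[0,1]$. The initial plant state $x(0)$ is independent of $(B,B',N,\gamma,\gamma')$. *Buffers.* The controller and the actuator have buffers $\mathbf b_c,\mathbf b_a$ of $\Lambda_c$ and $\Lambda_a$ commands in $\mathbb R^{l_u}$, $\bar N\le\Lambda_c$, $\Lambda_a\le\Lambda_c$,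 of effective lengths $\lambda_c,\lambda_a$; at time $0$ both are empty ($\mathbf b_c(0)=\mathbf b_a(0)=0$, $\lambda_c(0)=\lambda_a(0)=0$). At each time $u(t)$ is the first entry of $\mathbf b_a(t)$. With a measurable policy $\kappa:\mathbb R^{l_s}\to\mathbb R^{l_u}$ let $u_i(t)=\kappa(x_i'(t))$, $x_1'(t)=x(t)$, $x'_{i+1}(t)=f(x_i'(t),u_i(t))$. Let $S$ denote the shift of a buffer by one place (the first entry is dropped, a zero is appended). For $t\ge1$ put $$L(t)=\begin{cases}\min\{B(t),N(t),\Lambda_a\},&\gamma'(t)N(t)>0,\\ \min\{B(t),\lambda_c(t-1),\Lambda_a-\lambda_a(t-1)\},&\gamma'(t)N(t)=0,\ \lambda_a(t-1)\ne0,\\ 0,&\text{otherwise.}\end{cases}$$ 1. If $\gamma'(t)N(t)>0$ and $\gamma(t)=1$: $\mathbf b_c(t)=S^{L(t)}(u_1(t),\dots,u_{N(t)}(t),0,\dots)$, $\lambda_c(t)=N(t)-L(t)$, $\mathbf b_a(t)=(u_1(t),\dots,u_{L(t)}(t),0,\dots)$, $\lambda_a(t)=L(t)$. 2. If $\gamma'(t)N(t)=0$,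 $\gamma(t)=1$ and $\lambda_a(t-1)\neq0$: $\mathbf b_c(t)=S^{L(t)}\mathbf b_c(t-1)$, $\lambda_c(t)=\lambda_c(t-1)-L(t)$; $\mathbf b_a(t)$ consists of the entries $2,\dots,\lambda_a(t-1)$ of $\mathbf b_a(t-1)$ followed by the entries $1,\dots,L(t)$ of $\mathbf b_c(t-1)$ and zeros; $\lambda_a(t)=\lambda_a(t-1)+L(t)-1$. 3. If $\gamma'(t)N(t)=0$, $\gamma(t)=1$ and $\lambda_a(t-1)=0$: both buffers are set to zero and $\lambda_c(t)=\lambda_a(t)=0$. 4. If $\gamma(t)=0$: $\mathbf b_a(t)=S\mathbf b_a(t-1)$, $\lambda_a(t)=\max\{\lambda_a(t-1)-1,0\}$; the controller's buffer is unchanged if $\gamma'(t)N(t)=0$ and $\lambda_a(t-1)\ne0$, and otherwise it is set to zero with $\lambda_c(t)=0$. *Assumptions on the plant.* There are $W:\mathbb R^{l_s}\to\mathbb R_{\ge0}$, $\psi_1,\psi_2\in\mathcal K_\infty$, $\rho\in(0,1)$ and $\alpha>0$ such that for all $x$ $$\psi_1(|x|)\le W(x)\le\psi_2(|x|),\qquad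 W(f(x,\kappa(x)))\le\rho W(x),\qquad W(f(x,0))\le\alpha W(x),$$ and $\mathsf E[\psi_2(|x(0)|)]<\infty$. *The matrix $U$.* Let $Z(t)=(\lambda_c(t),\lambda_a(t),B(t+1),B'(t+1),N(t+1))$, a Markov chain; let $\mathcal S$ be the set of the states that it visits with positive probability, $\mathcal S_0\subseteq\mathcal S$ the set of those with $\lambda_a=0$, $S_0=|\mathcal S_0|$, and $V=\begin{pmatrix}V_{00}&V_{01}\\V_{10}&V_{11}\end{pmatrix}$ its transition matrix on $\mathcal S$, divided according to $\mathcal S_0$ and $\mathcal S\setminus\mathcal S_0$. Put $D(1)=V_{00}$, $D(l)=V_{01}V_{11}^{\,l-2}V_{10}$ for $l>1$, $\tilde V=\sum_{l\ge1}D(l)$ (the transition matrix of $Z$ observed at the times with $\lambda_a=0$), let $\pi$ be the stationary distribution of $\tilde V$, and $$r_{i,j}=\frac{\sum_{l\ge1}\rho^l[D(l)]_{i,j}}{[\tilde V]_{i,j}}\quad(\text{$0$ if }[\tilde V]_{i,j}=0),\qquad F=\operatorname{diag}(\pi)\,\tilde V\,\operatorname{diag}(\pi)^{-1}=[f_1\,|\,\cdots\,|\,f_{S_0}].$$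 $U\in\mathbb R^{S_0^2\times S_0^2}$ is obtained by stacking $U_1,\dots,U_{S_0}$, where $U_i\in\mathbb R^{S_0\times S_0^2}$ is block diagonal with the diagonal blocks $r_{1,i}f_1^\top,\dots,r_{S_0,i}f_{S_0}^\top$. $\lambda_{\max}$ denotes the spectral radius. **Theorem.** The matrix $U$ is nonnegative. If $$\Omega=\frac{\alpha}{\rho}\,\lambda_{\max}(U)<1,$$ then the closed-loop system is stochastically stable, that is, $\sum_{k=0}^\infty\mathsf E[\psi(|x(k)|)]<\infty$ for some $\psi\in\mathcal K_\infty$. Moreover $\lambda_{\max}(U)\le\max_{i,j}r_{i,j}$, so that the condition $\Omega<1$ is not more restrictive than $\frac{\alpha}{\rho}\max_{i,j}r_{i,j}<1$. -/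

import Mathlib

open MeasureTheory ProbabilityTheory
open scoped NNReal ENNReal

/-! ### Matrices of finite Markov chains -/

/-- Irreducibility of a transition matrix: every state can be reached from every state. -/
def ChainIrreducible {ι : Type*} [Fintype ι] [DecidableEq ι] (P : Matrix ι ι ℝ) : Prop :=
  ∀ i j, ∃ n : ℕ, 0 < (P ^ n) i j

/-- Aperiodicity of a transition matrix: for every state, the greatest common divisor of the
possible return times is `1`. -/
def ChainAperiodic {ι : Type*} [Fintype ι] [DecidableEq ι] (P : Matrix ι ι ℝ) : Prop :=
  ∀ i, ∀ d : ℕ, (∀ n : ℕ, 0 < n → 0 < (P ^ n) i i → d ∣ n) → d = 1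

/-- `π` is a stationary probability distribution of the transition matrix `P`. -/
structure IsStationaryDist {ι : Type*} [Fintype ι] (P : Matrix ι ι ℝ) (π : ι → ℝ) : Prop where
  nonneg : ∀ i, 0 ≤ π i
  sum_eq_one : ∑ i, π i = 1
  stationary : Matrix.vecMul π P = π

/-- First-return matrices of the chain with transition matrix `V` to the set of states `p`:
`D(1) = V₀₀` and `D(l) = V₀₁ V₁₁^(l-2) V₁₀` for `l > 1`, where the index `0` stands for the states
in `p` and the index `1` for the others. (`D(0)` is not used and set to `0`.) -/
def firstReturn {σ : Type*} [Fintype σ] [DecidableEq σ] (V : Matrix σ σ ℝ)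
    (p : σ → Prop) [DecidablePred p] : ℕ → Matrix {s // p s} {s // p s} ℝ
  | 0 => 0
  | 1 => V.toBlock p p
  | l + 2 => V.toBlock p (fun s => ¬ p s)
      * (V.toBlock (fun s => ¬ p s) (fun s => ¬ p s)) ^ l
      * V.toBlock (fun s => ¬ p s) p

/-- Spectral radius of a real square matrix: the largest modulus of its complex eigenvalues. -/
noncomputable def lambdaMax {ι : Type*} [Fintype ι] [DecidableEq ι] (A : Matrix ι ι ℝ) : ℝ :=
  (spectralRadius ℂ (A.map (fun a : ℝ => (a : ℂ)))).toReal

/-! ### The network: channels, computational resource, buffer lengths -/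

/-- The network of the dual-channel-dual-buffer control system.
* `capC`, `capA`: lengths of the controller's and of the actuator's buffer;
* the quality of the controller-actuator (C-A) channel is in `{0, …, Bmax}`, the quality of the
  sensor-controller (S-C) channel is one of `nSC` indices, the number of control commands that
  can be computed is in `{0, …, Nmax}`;
* `Q`: transition matrix of the Markov process `(B, B', N)`;
* `dropCA`: packet drop probability of the C-A channel;
* `g (gain b')`: packet drop probability of the S-C channel of quality `b'`, where `gain b'`
  is the channel power gain. -/
structure Network where
  capC : ℕ
  capA : ℕ
  Bmax : ℕ
  nSC : ℕ
  Nmax : ℕ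
  Q : Matrix (Fin (Bmax + 1) × Fin nSC × Fin (Nmax + 1))
        (Fin (Bmax + 1) × Fin nSC × Fin (Nmax + 1)) ℝ
  dropCA : ℝ
  gain : Fin nSC → ℝ
  g : ℝ → ℝ
  Nmax_le : Nmax ≤ capC
  capA_le : capA ≤ capC
  Q_nonneg : ∀ i j, 0 ≤ Q i j
  Q_sum : ∀ i, ∑ j, Q i j = 1
  dropCA_pos : 0 < dropCA
  dropCA_le_one : dropCA ≤ 1
  dropSC_nonneg : ∀ b, 0 ≤ g (gain b)
  dropSC_le_one : ∀ b, g (gain b) ≤ 1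

namespace Network

/-- Values `(b, b', n)` of the process `(B, B', N)`. -/
abbrev Mode (net : Network) : Type :=
  Fin (net.Bmax + 1) × Fin net.nSC × Fin (net.Nmax + 1)

/-- Probability of success (`true`) and failure (`false`) of a C-A transmission. -/
def probCA (net : Network) (γ : Bool) : ℝ := if γ then 1 - net.dropCA else net.dropCA

/-- Probability of success (`true`) and failure (`false`) of an S-C transmission. -/
def probSC (net : Network) (m : net.Mode) (γ' : Bool) : ℝ :=
  if γ' then 1 - net.g (net.gain m.2.1) else net.g (net.gain m.2.1)

/-- The event `γ' N > 0`: the controller computes new commands. -/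
def HasNew (net : Network) (m : net.Mode) (γ' : Bool) : Prop := γ' = true ∧ 0 < (m.2.2 : ℕ)

instance (net : Network) (m : net.Mode) (γ' : Bool) : Decidable (net.HasNew m γ') := by
  unfold HasNew; infer_instance

/-- The number `L` of commands to be transmitted, given the present value `m` of `(B, B', N)`, the
outcome `γ'` of the present S-C transmission, and the previous effective buffer lengths `l`
(`l.1` at the controller, `l.2` at the actuator). -/
def numSent (net : Network) (m : net.Mode) (γ' : Bool) (l : ℕ × ℕ) : ℕ :=
  if net.HasNew m γ' then min (m.1 : ℕ) (min (m.2.2 : ℕ) net.capA)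
  else if l.2 ≠ 0 then min (m.1 : ℕ) (min l.1 (net.capA - l.2))
  else 0

/-- Update of the effective buffer lengths `l = (λ_c, λ_a)`; `γ`, `γ'` are the outcomes of the
present C-A and S-C transmissions. -/
def lenStep (net : Network) (m : net.Mode) (γ γ' : Bool) (l : ℕ × ℕ) : ℕ × ℕ :=
  ( -- the length at the controller
    if net.HasNew m γ' then
      (if γ then (m.2.2 : ℕ) - net.numSent m γ' l else 0)
    else if l.2 = 0 then 0
    else if γ then l.1 - net.numSent m γ' l
    else l.1,
    -- the length at the actuator
    if γ = false then l.2 - 1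
    else if net.HasNew m γ' then net.numSent m γ' l
    else if l.2 = 0 then 0
    else l.2 + net.numSent m γ' l - 1 )

/-- The set in which the process `Z(t) = (λ_c(t), λ_a(t), B(t+1), B'(t+1), N(t+1))` takes its
values. -/
abbrev State (net : Network) : Type :=
  Fin (net.capC + 1) × Fin (min net.capA net.Nmax + 1) × net.Mode

/-- The transition probabilities of `Z`. In state `(λ_c, λ_a, m)` the next buffer lengths result
from `m` and from the outcomes of the two transmissions, and the next value of `(B, B', N)` is drawn
from the row `m` of `Q`. -/
def transZ (net : Network) : Matrix net.State net.State ℝ := fun s s' =>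
  net.Q s.2.2 s'.2.2 *
    ∑ γ : Bool, ∑ γ' : Bool, net.probCA γ * net.probSC s.2.2 γ' *
      (if net.lenStep s.2.2 γ γ' ((s.1 : ℕ), (s.2.1 : ℕ)) = ((s'.1 : ℕ), (s'.2.1 : ℕ))
        then 1 else 0)

/-- The states that `Z` visits with positive probability when both buffers are empty at time `0`
and `(B(0), B'(0), N(0)) = m₀`, so that `Z(0) = (0, 0, m)` with probability `Q m₀ m`. -/
def Visited (net : Network) (m₀ : net.Mode) (s : net.State) : Prop :=
  ∃ (m : net.Mode) (n : ℕ), 0 < net.Q m₀ m ∧ 0 < (net.transZ ^ n) (0, 0, m) s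

/-- The effective state space `𝓢` of `Z`. -/
abbrev EffState (net : Network) (m₀ : net.Mode) : Type := {s : net.State // net.Visited m₀ s}

noncomputable instance (net : Network) (m₀ : net.Mode) : Fintype (net.EffState m₀) :=
  Fintype.ofFinite _

instance (net : Network) (m₀ : net.Mode) : DecidableEq (net.EffState m₀) :=
  fun a b => decidable_of_iff (a.1 = b.1) Subtype.ext_iff.symm

/-- The transition matrix `V` of `Z` on its effective state space. -/
def V (net : Network) (m₀ : net.Mode) : Matrix (net.EffState m₀) (net.EffState m₀) ℝ :=
  fun s s' => net.transZ s.1 s'.1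

/-- The states with `λ_a = 0`: the actuator has run out of commands. -/
abbrev ActuatorEmpty (net : Network) (m₀ : net.Mode) (s : net.EffState m₀) : Prop :=
  (s.1.2.1 : ℕ) = 0

/-- The set `𝓢₀` of the states of `𝓢` with `λ_a = 0`. -/
abbrev OpenState (net : Network) (m₀ : net.Mode) : Type :=
  {s : net.EffState m₀ // net.ActuatorEmpty m₀ s}

instance (net : Network) (m₀ : net.Mode) : DecidableEq (net.OpenState m₀) :=
  fun a b => decidable_of_iff (a.1 = b.1) Subtype.ext_iff.symm

/-- The matrices `D(l)`: joint probabilities that the next visit to `𝓢₀` takes place after `l` steps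
and in a given state. -/
noncomputable def D (net : Network) (m₀ : net.Mode) (l : ℕ) :
    Matrix (net.OpenState m₀) (net.OpenState m₀) ℝ :=
  firstReturn (net.V m₀) (net.ActuatorEmpty m₀) l

/-- The transition matrix `Ṽ = ∑_{l ≥ 1} D(l)` of `Z` observed at its visits to `𝓢₀`. -/
noncomputable def Vtilde (net : Network) (m₀ : net.Mode) :
    Matrix (net.OpenState m₀) (net.OpenState m₀) ℝ :=
  fun i j => ∑' l : ℕ, net.D m₀ (l + 1) i j

/-- `r i j = (∑_{l ≥ 1} ρ^l D(l) i j) / Ṽ i j`, the conditional expectation of `ρ^Δ` for a cycle of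
length `Δ` from `i` to `j` (and `0` if there are no such cycles). -/
noncomputable def r (net : Network) (m₀ : net.Mode) (ρ : ℝ) (i j : net.OpenState m₀) : ℝ :=
  (∑' l : ℕ, ρ ^ (l + 1) * net.D m₀ (l + 1) i j) / net.Vtilde m₀ i j

/-- `F = diag(π) Ṽ diag(π)⁻¹`. -/
noncomputable def F (net : Network) (m₀ : net.Mode) (π : net.OpenState m₀ → ℝ) :
    Matrix (net.OpenState m₀) (net.OpenState m₀) ℝ :=
  Matrix.diagonal π * net.Vtilde m₀ * (Matrix.diagonal π)⁻¹

/-- The matrix `U`. Its rows form blocks `U_i`; the row `j` of `U_i` has in the column block `j` the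
vector `r_{j,i} f_jᵀ`, where `f_j` is the column `j` of `F`, and is zero in the other column
blocks. The index `(i, j)` stands for position `j` in block `i`. -/
noncomputable def U (net : Network) (m₀ : net.Mode) (ρ : ℝ) (π : net.OpenState m₀ → ℝ) :
    Matrix (net.OpenState m₀ × net.OpenState m₀) (net.OpenState m₀ × net.OpenState m₀) ℝ :=
  fun a b => if b.1 = a.2 then net.r m₀ ρ a.2 a.1 * net.F m₀ π b.2 a.2 else 0

/-- The law of the random network: `(B, B', N)` (here `m`) is a Markov process with transition
matrix `Q` that starts in `m₀`; given this process, the outcomes `γ(t)` and `γ'(t)` of the C-A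
and S-C transmissions are independent of each other and over time, with the drop probabilities
`dropCA` and `g (gain B'(t))`. -/
structure IsNetworkProcess (net : Network) (m₀ : net.Mode) {Ω : Type*} [MeasurableSpace Ω]
    (μ : Measure Ω) (m : ℕ → Ω → net.Mode) (γ γ' : ℕ → Ω → Bool) : Prop where
  measurable_m : ∀ t, Measurable (m t)
  measurable_γ : ∀ t, Measurable (γ t)
  measurable_γ' : ∀ t, Measurable (γ' t)
  law : ∀ (T : ℕ) (a : ℕ → net.Mode) (c c' : ℕ → Bool),
    μ {ω | ∀ t ≤ T, m t ω = a t ∧ γ t ω = c t ∧ γ' t ω = c' t} =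
      ENNReal.ofReal ((if a 0 = m₀ then 1 else 0)
        * (∏ t ∈ Finset.range T, net.Q (a t) (a (t + 1)))
        * ∏ t ∈ Finset.range (T + 1), (net.probCA (c t) * net.probSC (a t) (c' t)))

end Network

/-! ### Buffers, controller, actuator, plant -/

/-- The entry with (zero-based) index `i` of a buffer, zero beyond the end. -/
def bufEntry {E : Type*} [Zero E] {k : ℕ} (b : Fin k → E) (i : ℕ) : E :=
  if h : i < k then b ⟨i, h⟩ else 0

/-- The buffer shift: every entry moves one place ahead, the last one becomes zero. -/
def bufShift {E : Type*} [Zero E] {k : ℕ} (b : Fin k → E) : Fin k → E :=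
  fun i => bufEntry b ((i : ℕ) + 1)

/-- The tentative command with (zero-based) index `i` that is computed in the plant state `x`: the
policy `κ` at the state predicted `i` steps ahead. -/
def tentative {X E : Type*} (f : X → E → X) (κ : X → E) (x : X) (i : ℕ) : E :=
  κ ((fun y => f y (κ y))^[i] x)

/-- State of plant and buffers: plant state, contents of the controller's buffer and of the
actuator's buffer after the transmission, and effective buffer lengths `(λ_c, λ_a)`. -/
structure LoopState (net : Network) (X E : Type*) where
  x : X
  bc : Fin net.capC → E
  ba : Fin net.capA → E
  len : ℕ × ℕ

/-- The control input: the first command in the actuator's buffer. -/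
def LoopState.input {net : Network} {X E : Type*} [Zero E] (s : LoopState net X E) : E :=
  bufEntry s.ba 0

/-- One time step: the plant evolves under the present input, and the buffers are then updated
with the new plant state, the new value `m` of `(B, B', N)` and the new outcomes `γ`, `γ'` of the
C-A and S-C transmissions. -/
def loopStep (net : Network) {X E : Type*} [Zero E] (f : X → E → X) (κ : X → E)
    (m : net.Mode) (γ γ' : Bool) (s : LoopState net X E) : LoopState net X E :=
  let x' : X := f s.x s.input
  let L : ℕ := net.numSent m γ' s.len
  { x := x'
    bc :=
      if net.HasNew m γ' then
        (if γ then
          bufShift^[L] (fun i => if (i : ℕ) < (m.2.2 : ℕ) then tentative f κ x' i else 0)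
        else fun _ => 0)
      else if s.len.2 = 0 then fun _ => 0
      else if γ then bufShift^[L] s.bc
      else s.bc
    ba :=
      if γ = false then bufShift s.ba
      else if net.HasNew m γ' then
        fun i => if (i : ℕ) < L then tentative f κ x' i else 0
      else if s.len.2 = 0 then fun _ => 0
      else fun i =>
        if (i : ℕ) < s.len.2 - 1 then bufEntry s.ba ((i : ℕ) + 1)
        else if (i : ℕ) < s.len.2 - 1 + L then bufEntry s.bc ((i : ℕ) - (s.len.2 - 1))
        else 0
    len := net.lenStep m γ γ' s.len }

/-- The closed loop along a realization of the network, started in the plant state `x₀` with empty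
buffers. -/
def closedLoop (net : Network) {X E : Type*} [Zero E] (f : X → E → X) (κ : X → E)
    (m : ℕ → net.Mode) (γ γ' : ℕ → Bool) (x₀ : X) : ℕ → LoopState net X E
  | 0 => { x := x₀, bc := fun _ => 0, ba := fun _ => 0, len := (0, 0) }
  | t + 1 => loopStep net f κ (m (t + 1)) (γ (t + 1)) (γ' (t + 1))
      (closedLoop net f κ m γ γ' x₀ t)

/-! ### Stability -/

/-- Class `𝓚_∞`, in the convention used here: continuous, strictly increasing, zero at zero. -/
structure IsClassKInf (φ : ℝ≥0 → ℝ≥0) : Prop where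
  continuous : Continuous φ
  strictMono : StrictMono φ
  map_zero : φ 0 = 0

/-- Stochastic stability of a random trajectory: `∑ₖ E[ψ(|x(k)|)] < ∞` for some `ψ ∈ 𝓚_∞`. -/
def StochasticallyStable {Ω X : Type*} [MeasurableSpace Ω] [NormedAddCommGroup X]
    (μ : Measure Ω) (x : ℕ → Ω → X) : Prop :=
  ∃ ψ : ℝ≥0 → ℝ≥0, IsClassKInf ψ ∧ ∑' k : ℕ, ∫⁻ ω, (ψ ‖x k ω‖₊ : ℝ≥0∞) ∂μ < ⊤

/-!
The plant state `x(t)` satisfies `W(x(t)) ≤ W(x(0)) ∏_{k < t} c(k)`, where `c(k)` is `α` if the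
actuator's buffer is empty at time `k` and `ρ` otherwise: as long as it is not empty, its first
entry is `κ(x(k))`, because the buffers hold the commands predicted from the present state
(`BuffersPredict`, `lyapunov_closedLoop_le`). So it suffices that the expectations of these products
are summable, and for this that there is a finite function `h ≥ 0` on the effective states of `Z`
with `1 + c V h ≤ h`: then `(∏_{k < t} c(k)) E[h(Z(t)) | past]` decreases in mean by at least
`E[∏_{k < t} c(k)]` in each step (`IsNetworkProcess.tsum_lintegral_growthPath_lt_top`).

On the states with an empty actuator buffer, such an `h` is a solution of `h = C + (α / ρ) G h` with
`G = ∑ l, ρ ^ l D(l)`, and it is extended to the other states by the resolvent of `ρ V₁₁`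
(`exists_supersolution`). Now `G` is the entrywise product of `r` and `Ṽ`, so that the entrywise
product of `r` and `F` is `diag(π) G diag(π)⁻¹`; and `U` is a product of two rectangular matrices
whose product in the other order is the transpose of this matrix. Hence a left fixed point of `U`,
which exists by Gelfand's formula if `(α / ρ) λ_max(U) < 1`, gives the solution for `G`
(`exists_fixedPoint_of_lambdaMax_U`).

All of this needs `π > 0`, which holds because `Z` is irreducible on its effective state space: from
every state, sufficiently many packet drops in a row lead to empty buffers, and from there every
mode is reached (`V_irreducible`, `stationaryDist_pos`). Since `π` is stationary, the columns of `F`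
sum to `1`; so the row sums of `U` are entries of `r`, which bounds `λ_max(U)` by `max r`
(`lambdaMax_U_le`).
-/

/-! ### Nonnegative matrices -/

lemma matrix_mul_nonneg {ι κ τ : Type*} [Fintype κ] {A : Matrix ι κ ℝ} {B : Matrix κ τ ℝ}
    (hA : ∀ i j, 0 ≤ A i j) (hB : ∀ i j, 0 ≤ B i j) (i : ι) (j : τ) : 0 ≤ (A * B) i j :=
  Finset.sum_nonneg fun k _ => mul_nonneg (hA i k) (hB k j)

lemma matrix_pow_nonneg {ι : Type*} [Fintype ι] [DecidableEq ι] {A : Matrix ι ι ℝ}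
    (hA : ∀ i j, 0 ≤ A i j) (n : ℕ) : ∀ i j, 0 ≤ (A ^ n) i j := by
  induction n with
  | zero => intro i j; rw [pow_zero, Matrix.one_apply]; split_ifs <;> norm_num
  | succ n ih => rw [pow_succ]; exact matrix_mul_nonneg ih hA

lemma matrix_mul_pos {ι κ τ : Type*} [Fintype κ] {A : Matrix ι κ ℝ} {B : Matrix κ τ ℝ}
    (hA : ∀ i j, 0 ≤ A i j) (hB : ∀ i j, 0 ≤ B i j) {i : ι} {k : κ} {j : τ}
    (h₁ : 0 < A i k) (h₂ : 0 < B k j) : 0 < (A * B) i j :=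
  Finset.sum_pos' (fun k _ => mul_nonneg (hA i k) (hB k j)) ⟨k, Finset.mem_univ k, mul_pos h₁ h₂⟩

lemma reflTransGen_of_pow_pos {ι : Type*} [Fintype ι] [DecidableEq ι] {P : Matrix ι ι ℝ}
    (hP : ∀ i j, 0 ≤ P i j) {n : ℕ} {i j : ι} (h : 0 < (P ^ n) i j) :
    Relation.ReflTransGen (fun a b => 0 < P a b) i j := by
  induction n generalizing j with
  | zero =>
    rw [pow_zero, Matrix.one_apply] at h
    split_ifs at h with hij
    · rw [hij]
    · exact absurd h (lt_irrefl 0)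
  | succ n ih =>
    rw [pow_succ, Matrix.mul_apply] at h
    obtain ⟨k, -, hk⟩ := Finset.exists_ne_zero_of_sum_ne_zero h.ne'
    have h₁ := (matrix_pow_nonneg hP n i k).lt_of_ne' (left_ne_zero_of_mul hk)
    exact (ih h₁).tail ((hP k j).lt_of_ne' (right_ne_zero_of_mul hk))

lemma exists_pow_pos_of_reflTransGen {ι : Type*} [Fintype ι] [DecidableEq ι] {P : Matrix ι ι ℝ}
    (hP : ∀ i j, 0 ≤ P i j) {i j : ι} (h : Relation.ReflTransGen (fun a b => 0 < P a b) i j) :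
    ∃ n : ℕ, 0 < (P ^ n) i j := by
  induction h with
  | refl => exact ⟨0, by simp⟩
  | tail _ hbc ih =>
    obtain ⟨n, hn⟩ := ih
    exact ⟨n + 1, by rw [pow_succ]; exact matrix_mul_pos (matrix_pow_nonneg hP n) hP hn hbc⟩

/-! ### Spectral radius -/

section Spectral

attribute [local instance] Matrix.linftyOpNormedRing Matrix.linftyOpNormedAlgebra

variable {ι : Type*} [Fintype ι] [DecidableEq ι]

lemma norm_entry_le_linftyOpNorm (A : Matrix ι ι ℂ) (i j : ι) : ‖A i j‖₊ ≤ ‖A‖₊ := by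
  rw [Matrix.linfty_opNNNorm_def]
  refine le_trans ?_ (Finset.le_sup (f := fun i => ∑ j, ‖A i j‖₊) (Finset.mem_univ i))
  exact Finset.single_le_sum (f := fun j => ‖A i j‖₊) (fun _ _ => zero_le) (Finset.mem_univ j)

lemma map_ofReal_pow (A : Matrix ι ι ℝ) (n : ℕ) :
    (A.map (fun a : ℝ => (a : ℂ))) ^ n = (A ^ n).map (fun a : ℝ => (a : ℂ)) :=
  (map_pow (RingHom.mapMatrix (m := ι) Complex.ofRealHom) A n).symm

lemma spectralRadius_map_ofReal_ne_top [Nonempty ι] (A : Matrix ι ι ℝ) :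
    spectralRadius ℂ (A.map (fun a : ℝ => (a : ℂ))) ≠ ⊤ :=
  ((spectrum.spectralRadius_le_nnnorm (𝕜 := ℂ) _).trans_lt ENNReal.coe_lt_top).ne

/-- The spectral radius of a nonnegative matrix is at most its largest row sum. -/
lemma lambdaMax_le_of_sum_le [Nonempty ι] {A : Matrix ι ι ℝ} (hA : ∀ i j, 0 ≤ A i j) {c : ℝ}
    (hc : 0 ≤ c) (h : ∀ i, ∑ j, A i j ≤ c) : lambdaMax A ≤ c := by
  unfold lambdaMax
  refine ENNReal.toReal_le_of_le_ofReal hc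
    ((spectrum.spectralRadius_le_nnnorm (𝕜 := ℂ) _).trans ?_)
  rw [ENNReal.ofReal, ENNReal.coe_le_coe, Matrix.linfty_opNNNorm_def]
  refine Finset.sup_le fun i _ => ?_
  rw [← NNReal.coe_le_coe, Real.coe_toNNReal c hc, NNReal.coe_sum]
  refine le_trans (le_of_eq (Finset.sum_congr rfl fun j _ => ?_)) (h i)
  simp [abs_of_nonneg (hA i j)]

/-- Gelfand's formula makes the Neumann series of `c A` converge if `c λ_max(A) < 1`. -/
lemma summable_smul_pow_of_lambdaMax [Nonempty ι] {A : Matrix ι ι ℝ} {c : ℝ} (hc : 0 < c)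
    (h : c * lambdaMax A < 1) (i j : ι) : Summable fun n : ℕ => c ^ n * (A ^ n) i j := by
  set B : Matrix ι ι ℂ := A.map (fun a : ℝ => (a : ℂ)) with hB
  have hr : lambdaMax A < 1 / c := by rwa [lt_div_iff₀ hc, mul_comm]
  obtain ⟨q, hrq, hq⟩ := exists_between hr
  have hq₀ : 0 < q := lt_of_le_of_lt ENNReal.toReal_nonneg hrq
  have hcq : c * q < 1 := by rwa [lt_div_iff₀ hc, mul_comm] at hq
  have hlim := spectrum.pow_nnnorm_pow_one_div_tendsto_nhds_spectralRadius B
  have hlt : spectralRadius ℂ B < ENNReal.ofReal q :=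
    (ENNReal.lt_ofReal_iff_toReal_lt (spectralRadius_map_ofReal_ne_top A)).2 hrq
  have hev := hlim.eventually_lt_const hlt
  refine Summable.of_norm_bounded_eventually_nat (g := fun n => (c * q) ^ n)
    (summable_geometric_of_lt_one (by positivity) hcq) ?_
  filter_upwards [hev, Filter.eventually_gt_atTop 0] with n hn hn₀
  have hn₀' : (0 : ℝ) < n := by exact_mod_cast hn₀
  have h₁ : (‖B ^ n‖₊ : ℝ≥0∞) ≤ ENNReal.ofReal q ^ n := by
    have := ENNReal.rpow_le_rpow hn.le hn₀'.le
    rwa [← ENNReal.rpow_mul, one_div, inv_mul_cancel₀ hn₀'.ne', ENNReal.rpow_one,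
      ENNReal.rpow_natCast] at this
  have h₂ : ‖B ^ n‖ ≤ q ^ n := by
    rw [ENNReal.ofReal, ← ENNReal.coe_pow, ENNReal.coe_le_coe, ← NNReal.coe_le_coe] at h₁
    simpa [hq₀.le] using h₁
  have h₃ : |(A ^ n) i j| ≤ q ^ n := by
    have h₄ : ‖(B ^ n) i j‖ ≤ ‖B ^ n‖ := norm_entry_le_linftyOpNorm (B ^ n) i j
    have h₅ : (B ^ n) i j = ((A ^ n) i j : ℝ) := by rw [hB, map_ofReal_pow, Matrix.map_apply]
    rw [h₅, Complex.norm_real, Real.norm_eq_abs] at h₄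
    exact h₄.trans h₂
  rw [Real.norm_eq_abs, abs_mul, abs_of_nonneg (pow_nonneg hc.le n), mul_pow]
  gcongr

/-- If `c λ_max(A) < 1`, then the left fixed-point equation `y = v + c y A` with a nonnegative
right-hand side has a nonnegative solution. -/
lemma exists_nonneg_eq_add_smul_vecMul [Nonempty ι] {A : Matrix ι ι ℝ} (hA : ∀ i j, 0 ≤ A i j)
    {c : ℝ} (hc : 0 < c) (h : c * lambdaMax A < 1) {v : ι → ℝ} (hv : ∀ i, 0 ≤ v i) :
    ∃ y : ι → ℝ, (∀ i, 0 ≤ y i) ∧ ∀ j, y j = v j + c * ∑ i, y i * A i j := by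
  have hs := summable_smul_pow_of_lambdaMax hc h
  have hsum : ∀ j, Summable fun n : ℕ => ∑ i, v i * (c ^ n * (A ^ n) i j) := fun j =>
    summable_sum fun i _ => (hs i j).mul_left (v i)
  refine ⟨fun j => ∑' n : ℕ, ∑ i, v i * (c ^ n * (A ^ n) i j), fun j => tsum_nonneg fun n =>
    Finset.sum_nonneg fun i _ => mul_nonneg (hv i)
      (mul_nonneg (pow_nonneg hc.le n) (matrix_pow_nonneg hA n i j)), fun j => ?_⟩
  beta_reduce
  rw [(hsum j).tsum_eq_zero_add]
  congr 1
  · simp [Matrix.one_apply]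
  · simp_rw [← tsum_mul_right]
    rw [← Summable.tsum_finsetSum fun k _ => (hsum k).mul_right _, ← tsum_mul_left]
    refine tsum_congr fun n => ?_
    simp_rw [pow_succ A, Matrix.mul_apply, Finset.mul_sum, Finset.sum_mul]
    rw [Finset.sum_comm]
    simp_rw [Finset.mul_sum]
    refine Finset.sum_congr rfl fun k _ => Finset.sum_congr rfl fun i _ => by ring

lemma summable_pow_mul_pow_of_sum_le_one {A : Matrix ι ι ℝ} (hA : ∀ i j, 0 ≤ A i j)
    (hsum : ∀ i, ∑ j, A i j ≤ 1) {ρ : ℝ} (hρ₀ : 0 ≤ ρ) (hρ₁ : ρ < 1) (i j : ι) :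
    Summable fun n : ℕ => ρ ^ n * (A ^ n) i j := by
  have h : ∀ n : ℕ, ∀ i, ∑ j, (A ^ n) i j ≤ 1 := by
    intro n
    induction n with
    | zero => intro i; simp [Matrix.one_apply]
    | succ n ih =>
      intro i
      simp_rw [pow_succ, Matrix.mul_apply]
      rw [Finset.sum_comm]
      simp_rw [← Finset.mul_sum]
      exact (Finset.sum_le_sum fun k _ => mul_le_of_le_one_right
        (matrix_pow_nonneg hA n i k) (hsum k)).trans (ih i)
  refine (summable_geometric_of_lt_one hρ₀ hρ₁).of_nonneg_of_le
    (fun n => mul_nonneg (pow_nonneg hρ₀ n) (matrix_pow_nonneg hA n i j)) fun n => ?_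
  exact mul_le_of_le_one_right (pow_nonneg hρ₀ n)
    ((Finset.single_le_sum (fun j _ => matrix_pow_nonneg hA n i j) (Finset.mem_univ j)).trans
      (h n i))

end Spectral

/-! ### First returns of a finite Markov chain -/

lemma sum_toBlock_le_one {σ : Type*} [Fintype σ] {V : Matrix σ σ ℝ} (p : σ → Prop)
    [DecidablePred p] (hs : ∀ i, ∑ j, V i j ≤ 1) (i : σ) :
    ∑ j : {s // p s}, V i j + ∑ j : {s // ¬ p s}, V i j ≤ 1 :=
  (Fintype.sum_subtype_add_sum_subtype p (V i)).le.trans (hs i)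

section FirstReturn

variable {σ : Type*} [Fintype σ] [DecidableEq σ] {V : Matrix σ σ ℝ} (p : σ → Prop)
  [DecidablePred p]

lemma firstReturn_nonneg (hV : ∀ i j, 0 ≤ V i j) (l : ℕ) (i j : {s // p s}) :
    0 ≤ firstReturn V p l i j := by
  match l with
  | 0 => exact le_rfl
  | 1 => exact hV _ _
  | l + 2 =>
    exact matrix_mul_nonneg (matrix_mul_nonneg (fun _ _ => hV _ _)
      (matrix_pow_nonneg (fun _ _ => hV _ _) l)) (fun _ _ => hV _ _) i j

/-- Either the chain has returned within `n + 1` steps, or it has stayed outside `p` since the first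
step. -/
lemma sum_firstReturn_add_le_one (hV : ∀ i j, 0 ≤ V i j) (hs : ∀ i, ∑ j, V i j ≤ 1) (n : ℕ)
    (i : {s // p s}) :
    ∑ l ∈ Finset.range (n + 1), ∑ j, firstReturn V p (l + 1) i j
      + ∑ k, (V.toBlock p (fun s => ¬ p s)
        * (V.toBlock (fun s => ¬ p s) (fun s => ¬ p s)) ^ n) i k ≤ 1 := by
  induction n with
  | zero =>
    simpa [firstReturn] using sum_toBlock_le_one p hs i
  | succ n ih =>
    rw [Finset.sum_range_succ, add_assoc]
    refine le_trans (add_le_add le_rfl ?_) ih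
    set X := V.toBlock p (fun s => ¬ p s)
        * (V.toBlock (fun s => ¬ p s) (fun s => ¬ p s)) ^ n with hX
    have hXn : ∀ i k, 0 ≤ X i k := matrix_mul_nonneg (fun _ _ => hV _ _)
      (matrix_pow_nonneg (fun _ _ => hV _ _) n)
    have h₁ : firstReturn V p (n + 1 + 1) = X * V.toBlock (fun s => ¬ p s) p := rfl
    rw [h₁, pow_succ, ← Matrix.mul_assoc, ← hX]
    simp_rw [Matrix.mul_apply]
    rw [Finset.sum_comm (s := (Finset.univ : Finset {s // p s})),
      Finset.sum_comm (s := (Finset.univ : Finset {s // ¬ p s})) (f := fun k j => X i j * _),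
      ← Finset.sum_add_distrib]
    refine Finset.sum_le_sum fun k _ => ?_
    rw [← Finset.mul_sum, ← Finset.mul_sum, ← mul_add]
    exact mul_le_of_le_one_right (hXn i k) (sum_toBlock_le_one p hs k)

lemma sum_range_firstReturn_le_one (hV : ∀ i j, 0 ≤ V i j) (hs : ∀ i, ∑ j, V i j ≤ 1) (n : ℕ)
    (i : {s // p s}) : ∑ l ∈ Finset.range n, ∑ j, firstReturn V p (l + 1) i j ≤ 1 := by
  refine le_trans ?_ ((le_add_of_nonneg_right (Finset.sum_nonneg fun k _ =>
    matrix_mul_nonneg (fun _ _ => hV _ _) (matrix_pow_nonneg (fun _ _ => hV _ _) n) i k)).trans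
      (sum_firstReturn_add_le_one p hV hs n i))
  rw [Finset.sum_range_succ]
  exact le_add_of_nonneg_right (Finset.sum_nonneg fun j _ => firstReturn_nonneg p hV _ i j)

lemma summable_firstReturn (hV : ∀ i j, 0 ≤ V i j) (hs : ∀ i, ∑ j, V i j ≤ 1)
    (i j : {s // p s}) : Summable fun l : ℕ => firstReturn V p (l + 1) i j := by
  refine summable_of_sum_range_le (c := 1) (fun _ => firstReturn_nonneg p hV _ i j) fun n => ?_
  refine le_trans (Finset.sum_le_sum fun l _ => ?_) (sum_range_firstReturn_le_one p hV hs n i)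
  exact Finset.single_le_sum (fun j _ => firstReturn_nonneg p hV _ i j) (Finset.mem_univ j)

lemma summable_pow_mul_firstReturn (hV : ∀ i j, 0 ≤ V i j) (hs : ∀ i, ∑ j, V i j ≤ 1) {ρ : ℝ}
    (hρ₀ : 0 ≤ ρ) (hρ₁ : ρ ≤ 1) (i j : {s // p s}) :
    Summable fun l : ℕ => ρ ^ (l + 1) * firstReturn V p (l + 1) i j :=
  (summable_firstReturn p hV hs i j).of_nonneg_of_le
    (fun _ => mul_nonneg (pow_nonneg hρ₀ _) (firstReturn_nonneg p hV _ i j))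
    fun _ => mul_le_of_le_one_left (firstReturn_nonneg p hV _ i j) (pow_le_one₀ hρ₀ hρ₁)

/-- In an irreducible chain the embedded chain is irreducible: a set of states in `p` that is closed
under first returns contains all of `p` if it is nonempty. -/
lemma forall_of_firstReturn_closed (hV : ∀ i j, 0 ≤ V i j)
    (hirr : ∀ s t, Relation.ReflTransGen (fun a b => 0 < V a b) s t) {A : {s // p s} → Prop}
    (hA : ∀ l i j, A i → 0 < firstReturn V p l i j → A j) {i : {s // p s}} (hi : A i)
    (j : {s // p s}) : A j := by
  -- A state outside `p` is good if every state of `p` that can be entered next from it is in `A`.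
  let E : ℕ → Matrix {s // ¬ p s} {s // p s} ℝ := fun l =>
    (V.toBlock (fun s => ¬ p s) (fun s => ¬ p s)) ^ l * V.toBlock (fun s => ¬ p s) p
  let good : σ → Prop := fun s =>
    (∀ h : p s, A ⟨s, h⟩) ∧ ∀ h : ¬ p s, ∀ l k, 0 < E l ⟨s, h⟩ k → A k
  have hE : ∀ l i j, 0 ≤ E l i j := fun l =>
    matrix_mul_nonneg (matrix_pow_nonneg (fun _ _ => hV _ _) l) (fun _ _ => hV _ _)
  have hstep : ∀ s t, good s → 0 < V s t → good t := by
    intro s t hs hst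
    refine ⟨fun ht => ?_, fun ht l k hk => ?_⟩
    · by_cases h : p s
      · exact hA 1 ⟨s, h⟩ ⟨t, ht⟩ (hs.1 h) hst
      · refine hs.2 h 0 ⟨t, ht⟩ ?_
        simp only [E, pow_zero, Matrix.one_mul]
        exact hst
    · by_cases h : p s
      · refine hA (l + 2) ⟨s, h⟩ k (hs.1 h) ?_
        simp only [firstReturn, Matrix.mul_assoc]
        exact matrix_mul_pos (A := V.toBlock p (fun s => ¬ p s)) (k := ⟨t, ht⟩)
          (fun _ _ => hV _ _) (hE l) hst hk
      · refine hs.2 h (l + 1) k ?_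
        simp only [E, pow_succ', Matrix.mul_assoc]
        exact matrix_mul_pos (A := V.toBlock (fun s => ¬ p s) (fun s => ¬ p s)) (k := ⟨t, ht⟩)
          (fun _ _ => hV _ _) (hE l) hst hk
  have hgood : ∀ t, good t := by
    intro t
    induction hirr i.1 t with
    | refl => exact ⟨fun _ => hi, fun h => absurd i.2 h⟩
    | tail _ hbc ih => exact hstep _ _ ih hbc
  exact (hgood j.1).1 j.2

/-- Let every step from a state in `p` be weighted with `α` and every other step with `ρ < 1`. A
solution `h₀` on `p` of the inhomogeneous equation of the weighted embedded chain, whose matrix is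
`α / ρ * ∑ l, ρ ^ l * D(l)`, extends to a function `h` on all states with `1 + weight * V h ≤ h`,
provided that the inhomogeneity `C` is large enough to account for the cost of an excursion. -/
lemma exists_supersolution (hV : ∀ i j, 0 ≤ V i j) (hs : ∀ i, ∑ j, V i j ≤ 1) {ρ α : ℝ}
    (hρ₀ : 0 < ρ) (hρ₁ : ρ < 1) (hα : 0 < α) :
    ∃ C : ℝ, 0 ≤ C ∧ ∀ h₀ : {s // p s} → ℝ, (∀ i, 0 ≤ h₀ i) →
      (∀ i, h₀ i = C + α / ρ * ∑ j, (∑' l : ℕ, ρ ^ (l + 1) * firstReturn V p (l + 1) i j) * h₀ j) →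
      ∃ h : σ → ℝ, (∀ s, 0 ≤ h s) ∧ ∀ s, 1 + (if p s then α else ρ) * ∑ t, V s t * h t ≤ h s := by
  set V₀₁ := V.toBlock p (fun s => ¬ p s) with hV₀₁
  set V₁₁ := V.toBlock (fun s => ¬ p s) (fun s => ¬ p s) with hV₁₁
  set V₁₀ := V.toBlock (fun s => ¬ p s) p with hV₁₀
  have hV₁₁n : ∀ i j, 0 ≤ V₁₁ i j := fun _ _ => hV _ _
  have hsR : ∀ i j, Summable fun n : ℕ => ρ ^ n * (V₁₁ ^ n) i j :=
    summable_pow_mul_pow_of_sum_le_one hV₁₁n (fun i => (le_add_of_nonneg_left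
      (Finset.sum_nonneg fun _ _ => hV _ _)).trans (sum_toBlock_le_one p hs i)) hρ₀.le hρ₁
  -- The resolvent of the chain outside `p`.
  let R : Matrix {s // ¬ p s} {s // ¬ p s} ℝ := fun i j => ∑' n : ℕ, ρ ^ n * (V₁₁ ^ n) i j
  have hRn : ∀ i j, 0 ≤ R i j := fun i j => tsum_nonneg fun n =>
    mul_nonneg (pow_nonneg hρ₀.le n) (matrix_pow_nonneg hV₁₁n n i j)
  have hR : R = 1 + ρ • (V₁₁ * R) := by
    ext i j
    change ∑' n : ℕ, ρ ^ n * (V₁₁ ^ n) i j = _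
    rw [(hsR i j).tsum_eq_zero_add, Matrix.add_apply, Matrix.smul_apply, Matrix.mul_apply,
      pow_zero, pow_zero, one_mul, smul_eq_mul]
    congr 1
    simp only [R, ← tsum_mul_left]
    rw [← Summable.tsum_finsetSum fun k _ => (hsR k j).mul_left _, ← tsum_mul_left]
    refine tsum_congr fun n => ?_
    rw [pow_succ' V₁₁, Matrix.mul_apply, Finset.mul_sum, Finset.mul_sum]
    exact Finset.sum_congr rfl fun k _ => by ring
  have hG : ∀ i j, ∑' l : ℕ, ρ ^ (l + 1) * firstReturn V p (l + 1) i j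
      = ρ * V i j + ρ ^ 2 * (V₀₁ * R * V₁₀) i j := by
    intro i j
    rw [(summable_pow_mul_firstReturn p hV hs hρ₀.le hρ₁.le i j).tsum_eq_zero_add]
    congr 1
    · simp [firstReturn]
    · have h₁ : HasSum
          (fun n : ℕ => ρ ^ 2 * ∑ x, (∑ k, V₀₁ i k * (ρ ^ n * (V₁₁ ^ n) k x)) * V₁₀ x j)
          (ρ ^ 2 * ∑ x, (∑ k, V₀₁ i k * R k x) * V₁₀ x j) :=
        (hasSum_sum fun x _ => (hasSum_sum fun k _ =>
          (hsR k x).hasSum.mul_left _).mul_right _).mul_left _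
      simp only [Matrix.mul_apply]
      rw [← h₁.tsum_eq]
      refine tsum_congr fun n => ?_
      change ρ ^ (n + 2) * (V₀₁ * V₁₁ ^ n * V₁₀) i j = _
      simp only [Matrix.mul_apply, Finset.mul_sum, Finset.sum_mul]
      exact Finset.sum_congr rfl fun x _ => Finset.sum_congr rfl fun k _ => by ring
  have hV₀₁n : ∀ i j, 0 ≤ V₀₁ i j := fun _ _ => hV _ _
  have hVR : ∀ i, 0 ≤ (V₀₁.mulVec (R.mulVec 1)) i := fun i => Finset.sum_nonneg fun k _ =>
    mul_nonneg (hV₀₁n i k) (Finset.sum_nonneg fun j _ => mul_nonneg (hRn k j) zero_le_one)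
  refine ⟨1 + ∑ i, α * (V₀₁.mulVec (R.mulVec 1)) i, add_nonneg zero_le_one
    (Finset.sum_nonneg fun i _ => mul_nonneg hα.le (hVR i)), fun h₀ hh₀ heq => ?_⟩
  let h₁ : {s // ¬ p s} → ℝ := R.mulVec (1 + ρ • V₁₀.mulVec h₀)
  have hh₁n : ∀ k, 0 ≤ h₁ k := fun k => Finset.sum_nonneg fun j _ => mul_nonneg (hRn k j)
    (add_nonneg zero_le_one (mul_nonneg hρ₀.le
      (Finset.sum_nonneg fun i _ => mul_nonneg (hV _ _) (hh₀ i))))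
  have hh₁ : h₁ = 1 + ρ • (V₁₀.mulVec h₀ + V₁₁.mulVec h₁) := by
    change R.mulVec (1 + ρ • V₁₀.mulVec h₀) = _
    conv_lhs => rw [hR, Matrix.add_mulVec, Matrix.one_mulVec, Matrix.smul_mulVec,
      ← Matrix.mulVec_mulVec]
    rw [smul_add, add_assoc]
  have hV₀₁h₁ : V₀₁.mulVec h₁
      = V₀₁.mulVec (R.mulVec 1) + ρ • (V₀₁ * R * V₁₀).mulVec h₀ := by
    change V₀₁.mulVec (R.mulVec (1 + ρ • V₁₀.mulVec h₀)) = _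
    simp only [Matrix.mulVec_add, Matrix.mulVec_smul, Matrix.mulVec_mulVec, Matrix.mul_assoc]
  have hsplit : ∀ g : σ → ℝ, ∑ t, g t = ∑ t : {s // p s}, g t + ∑ t : {s // ¬ p s}, g t :=
    fun g => (Fintype.sum_subtype_add_sum_subtype p g).symm
  refine ⟨fun s => if hs : p s then h₀ ⟨s, hs⟩ else h₁ ⟨s, hs⟩, fun s => ?_, fun s => ?_⟩
  · dsimp only
    split_ifs with hps
    · exact hh₀ _
    · exact hh₁n _
  · have e₁ : ∑ t, V s t * (if hs : p t then h₀ ⟨t, hs⟩ else h₁ ⟨t, hs⟩)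
        = ∑ t : {s // p s}, V s t * h₀ t + ∑ t : {s // ¬ p s}, V s t * h₁ t := by
      rw [hsplit]
      congr 1
      · exact Finset.sum_congr rfl fun t _ => by rw [dif_pos t.2]
      · exact Finset.sum_congr rfl fun t _ => by rw [dif_neg t.2]
    simp only [e₁]
    by_cases hps : p s
    · rw [if_pos hps, dif_pos hps, heq ⟨s, hps⟩]
      have e₂ : ∑ t : {s // ¬ p s}, V s t * h₁ t = _ := congrFun hV₀₁h₁ ⟨s, hps⟩
      have e₃ : ∑ j, (∑' l : ℕ, ρ ^ (l + 1) * firstReturn V p (l + 1) ⟨s, hps⟩ j) * h₀ j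
          = ρ * ∑ t : {s // p s}, V s t * h₀ t + ρ ^ 2 * ((V₀₁ * R * V₁₀).mulVec h₀) ⟨s, hps⟩ := by
        simp only [hG, add_mul, Finset.sum_add_distrib, Matrix.mulVec, dotProduct, Finset.mul_sum,
          mul_assoc]
      have e₄ : α * (V₀₁.mulVec (R.mulVec 1)) ⟨s, hps⟩ ≤ ∑ i, α * (V₀₁.mulVec (R.mulVec 1)) i :=
        Finset.single_le_sum (f := fun i => α * (V₀₁.mulVec (R.mulVec 1)) i)
          (fun i _ => mul_nonneg hα.le (hVR i)) (Finset.mem_univ _)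
      rw [e₃, e₂, Pi.add_apply, Pi.smul_apply, smul_eq_mul]
      have e₅ : ∀ a b : ℝ, α / ρ * (ρ * a + ρ ^ 2 * b) = α * (a + ρ * b) := fun a b => by
        field_simp
      rw [e₅]
      linarith
    · rw [if_neg hps, dif_neg hps]
      exact (congrFun hh₁ ⟨s, hps⟩).ge

end FirstReturn

/-! ### The chain of buffer lengths and modes -/

namespace Network

variable (net : Network)

lemma probCA_nonneg (c : Bool) : 0 ≤ net.probCA c := by
  cases c
  · exact net.dropCA_pos.le
  · exact sub_nonneg.2 net.dropCA_le_one

lemma probSC_nonneg (m : net.Mode) (c : Bool) : 0 ≤ net.probSC m c := by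
  cases c
  · exact net.dropSC_nonneg _
  · exact sub_nonneg.2 (net.dropSC_le_one _)

lemma sum_probCA : ∑ c : Bool, net.probCA c = 1 := by simp [probCA]

lemma sum_probSC (m : net.Mode) : ∑ c : Bool, net.probSC m c = 1 := by simp [probSC]

lemma probSC_pos (m : net.Mode) : ∃ c, 0 < net.probSC m c := by
  obtain ⟨c, -, hc⟩ := Finset.exists_ne_zero_of_sum_ne_zero
    ((net.sum_probSC m).trans_ne one_ne_zero)
  exact ⟨c, (net.probSC_nonneg m c).lt_of_ne' hc⟩

lemma exists_Q_pos (m : net.Mode) : ∃ m', 0 < net.Q m m' := by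
  obtain ⟨m', -, hm⟩ := Finset.exists_ne_zero_of_sum_ne_zero ((net.Q_sum m).trans_ne one_ne_zero)
  exact ⟨m', (net.Q_nonneg m m').lt_of_ne' hm⟩

lemma transZ_nonneg (s s' : net.State) : 0 ≤ net.transZ s s' :=
  mul_nonneg (net.Q_nonneg _ _) (Finset.sum_nonneg fun c _ => Finset.sum_nonneg fun c' _ =>
    mul_nonneg (mul_nonneg (net.probCA_nonneg c) (net.probSC_nonneg _ c'))
      (by split_ifs <;> norm_num))

/-- The buffer lengths satisfy `λ_a ≤ Λ_a` and `λ_c + λ_a ≤ N̄`. -/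
def LenBound (l : ℕ × ℕ) : Prop := l.2 ≤ net.capA ∧ l.1 + l.2 ≤ net.Nmax

lemma numSent_le_fst (m : net.Mode) (c' : Bool) (l : ℕ × ℕ) (h : ¬ net.HasNew m c') :
    net.numSent m c' l ≤ l.1 := by
  unfold numSent; rw [if_neg h]; split_ifs <;> omega

lemma numSent_le_sub (m : net.Mode) (c' : Bool) (l : ℕ × ℕ) (h : ¬ net.HasNew m c') :
    net.numSent m c' l ≤ net.capA - l.2 := by
  unfold numSent; rw [if_neg h]; split_ifs <;> omega

lemma numSent_le_of_hasNew (m : net.Mode) (c' : Bool) (l : ℕ × ℕ) (h : net.HasNew m c') :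
    net.numSent m c' l ≤ (m.2.2 : ℕ) ∧ net.numSent m c' l ≤ net.capA := by
  unfold numSent; rw [if_pos h]; omega

lemma LenBound.lenStep {net : Network} {l : ℕ × ℕ} (hl : net.LenBound l) (m : net.Mode)
    (c c' : Bool) : net.LenBound (net.lenStep m c c' l) := by
  obtain ⟨h₁, h₂⟩ := hl
  have hN : (m.2.2 : ℕ) ≤ net.Nmax := Nat.lt_succ_iff.1 m.2.2.2
  unfold LenBound Network.lenStep
  by_cases h : net.HasNew m c'
  · have := net.numSent_le_of_hasNew m c' l h
    cases c <;> simp [h] <;> omega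
  · have h₃ := net.numSent_le_fst m c' l h
    have h₄ := net.numSent_le_sub m c' l h
    cases c <;> by_cases h₅ : l.2 = 0 <;> simp [h, h₅] <;> omega

/-- The buffer lengths of a state of `Z`. -/
def lens {net : Network} (s : net.State) : ℕ × ℕ := ((s.1 : ℕ), (s.2.1 : ℕ))

lemma state_ext {s t : net.State} (h₁ : lens s = lens t) (h₂ : s.2.2 = t.2.2) : s = t := by
  obtain ⟨a, b, m⟩ := s
  obtain ⟨a', b', m'⟩ := t
  simp only [lens, Prod.mk.injEq] at h₁
  exact Prod.ext (Fin.ext h₁.1) (Prod.ext (Fin.ext h₁.2) h₂)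

lemma exists_state_of_lenBound {l : ℕ × ℕ} (hl : net.LenBound l) (m : net.Mode) :
    ∃ s : net.State, lens s = l ∧ s.2.2 = m := by
  obtain ⟨h₁, h₂⟩ := hl
  have := net.Nmax_le
  exact ⟨(⟨l.1, by omega⟩, ⟨l.2, by omega⟩, m), rfl, rfl⟩

lemma transZ_pos_iff {s s' : net.State} : 0 < net.transZ s s' ↔
    0 < net.Q s.2.2 s'.2.2 ∧ ∃ c c', 0 < net.probCA c ∧ 0 < net.probSC s.2.2 c' ∧
      net.lenStep s.2.2 c c' (lens s) = lens s' := by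
  constructor
  · intro h
    have hQ : net.Q s.2.2 s'.2.2 ≠ 0 := fun h0 => h.ne' (by rw [transZ, h0, zero_mul])
    refine ⟨(net.Q_nonneg _ _).lt_of_ne' hQ, ?_⟩
    obtain ⟨c, -, hc⟩ := Finset.exists_ne_zero_of_sum_ne_zero (right_ne_zero_of_mul h.ne')
    obtain ⟨c', -, hc'⟩ := Finset.exists_ne_zero_of_sum_ne_zero hc
    have h₁ := left_ne_zero_of_mul hc'
    refine ⟨c, c', (net.probCA_nonneg c).lt_of_ne' (left_ne_zero_of_mul h₁),
      (net.probSC_nonneg _ c').lt_of_ne' (right_ne_zero_of_mul h₁), ?_⟩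
    by_contra hne
    exact right_ne_zero_of_mul hc' (if_neg hne)
  · rintro ⟨hQ, c, c', hc, hc', hl⟩
    have hn : ∀ c c', 0 ≤ net.probCA c * net.probSC s.2.2 c' *
      (if net.lenStep s.2.2 c c' ((s.1 : ℕ), (s.2.1 : ℕ)) = ((s'.1 : ℕ), (s'.2.1 : ℕ))
        then (1 : ℝ) else 0) := fun c c' =>
      mul_nonneg (mul_nonneg (net.probCA_nonneg c) (net.probSC_nonneg _ c'))
        (by split_ifs <;> norm_num)
    refine mul_pos hQ (Finset.sum_pos' (fun c _ => Finset.sum_nonneg fun c' _ => hn c c')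
      ⟨c, Finset.mem_univ c, Finset.sum_pos' (fun c' _ => hn c c') ⟨c', Finset.mem_univ c', ?_⟩⟩)
    rw [if_pos (by exact hl), mul_one]
    exact mul_pos hc hc'

lemma sum_transZ_le_one (s : net.State) : ∑ s', net.transZ s s' ≤ 1 := by
  have h₁ : ∀ c c', ∑ s' : net.State, net.Q s.2.2 s'.2.2 *
      (if net.lenStep s.2.2 c c' ((s.1 : ℕ), (s.2.1 : ℕ)) = ((s'.1 : ℕ), (s'.2.1 : ℕ))
        then (1 : ℝ) else 0) ≤ 1 := by
    intro c c'
    simp only [mul_ite, mul_one, mul_zero]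
    rw [← Finset.sum_filter, ← Finset.sum_image (f := fun m' => net.Q s.2.2 m')
      (g := fun t : net.State => t.2.2)]
    · exact (Finset.sum_le_sum_of_subset_of_nonneg (Finset.subset_univ _)
        fun _ _ _ => net.Q_nonneg _ _).trans (net.Q_sum s.2.2).le
    · intro t ht t' ht' htt
      have e := (Finset.mem_filter.1 ht).2
      have e' := (Finset.mem_filter.1 ht').2
      exact net.state_ext (e.symm.trans e') htt
  calc ∑ s', net.transZ s s'
      = ∑ c, ∑ c', net.probCA c * net.probSC s.2.2 c' * ∑ s' : net.State, net.Q s.2.2 s'.2.2 *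
        (if net.lenStep s.2.2 c c' ((s.1 : ℕ), (s.2.1 : ℕ)) = ((s'.1 : ℕ), (s'.2.1 : ℕ))
        then (1 : ℝ) else 0) := by
        simp only [transZ, Finset.mul_sum]
        rw [Finset.sum_comm]
        refine Finset.sum_congr rfl fun c _ => ?_
        rw [Finset.sum_comm]
        exact Finset.sum_congr rfl fun c' _ => Finset.sum_congr rfl fun s' _ => by ring
    _ ≤ ∑ c, ∑ c', net.probCA c * net.probSC s.2.2 c' :=
        Finset.sum_le_sum fun c _ => Finset.sum_le_sum fun c' _ => mul_le_of_le_one_right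
          (mul_nonneg (net.probCA_nonneg c) (net.probSC_nonneg _ c')) (h₁ c c')
    _ = 1 := by simp_rw [← Finset.mul_sum, sum_probSC, mul_one, sum_probCA]

variable {net} {m₀ : Mode net}

lemma visited_iff {s : net.State} : net.Visited m₀ s ↔ ∃ m, 0 < net.Q m₀ m ∧
    Relation.ReflTransGen (fun a b => 0 < net.transZ a b) (0, 0, m) s :=
  ⟨fun ⟨m, _, hm, hn⟩ => ⟨m, hm, reflTransGen_of_pow_pos net.transZ_nonneg hn⟩,
    fun ⟨m, hm, h⟩ =>
      let ⟨n, hn⟩ := exists_pow_pos_of_reflTransGen net.transZ_nonneg h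
      ⟨m, n, hm, hn⟩⟩

lemma Visited.tail {s t : net.State} (hs : net.Visited m₀ s) (h : 0 < net.transZ s t) :
    net.Visited m₀ t := by
  rw [visited_iff] at hs ⊢
  obtain ⟨m, hm, hr⟩ := hs
  exact ⟨m, hm, hr.tail h⟩

lemma visited_zero {m : net.Mode} (hm : 0 < net.Q m₀ m) : net.Visited m₀ (0, 0, m) :=
  visited_iff.2 ⟨m, hm, .refl⟩

lemma Visited.lenBound {s : net.State} (hs : net.Visited m₀ s) : net.LenBound (lens s) := by
  obtain ⟨m, -, hr⟩ := visited_iff.1 hs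
  clear hs
  induction hr with
  | refl => exact ⟨Nat.zero_le _, Nat.zero_le _⟩
  | tail _ hbc ih =>
    obtain ⟨-, c, c', -, -, hl⟩ := net.transZ_pos_iff.1 hbc
    rw [← hl]
    exact ih.lenStep _ c c'

/-- A dropped packet: `λ_a` decreases, and `λ_c` becomes zero once `λ_a` is. -/
lemma exists_drop_step (lc : Fin (net.capC + 1)) (la : Fin (min net.capA net.Nmax + 1))
    {m m' : net.Mode} (hm : 0 < net.Q m m') :
    ∃ (lc' : Fin (net.capC + 1)) (la' : Fin (min net.capA net.Nmax + 1)), (la' : ℕ) = la - 1 ∧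
      ((la : ℕ) = 0 → lc' = 0) ∧ 0 < net.transZ (lc, la, m) (lc', la', m') := by
  obtain ⟨c', hc'⟩ := net.probSC_pos m
  have h₁ : (net.lenStep m false c' ((lc : ℕ), (la : ℕ))).1 ≤ lc := by
    unfold lenStep; dsimp only; split_ifs <;> simp_all
  have h₂ : (net.lenStep m false c' ((lc : ℕ), (la : ℕ))).2 = la - 1 := by
    simp [lenStep]
  refine ⟨⟨(net.lenStep m false c' ((lc : ℕ), (la : ℕ))).1, by omega⟩, ⟨la - 1, by omega⟩, rfl,
    fun h => ?_, net.transZ_pos_iff.2 ⟨hm, false, c', net.dropCA_pos, hc', ?_⟩⟩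
  · apply Fin.ext
    simp [lenStep, h]
  · exact Prod.ext rfl h₂

/-- If the controller-actuator channel fails for long enough, both buffers run empty. -/
lemma exists_reach_empty (s : net.State) :
    ∃ m, Relation.ReflTransGen (fun a b => 0 < net.transZ a b) s (0, 0, m) := by
  obtain ⟨lc, la, m⟩ := s
  induction hn : (la : ℕ) generalizing lc la m with
  | zero =>
    obtain ⟨m', hm'⟩ := net.exists_Q_pos m
    obtain ⟨lc', la', h₁, h₂, h₃⟩ := exists_drop_step lc la hm'
    obtain rfl := h₂ hn
    obtain rfl : la' = 0 := Fin.ext (by rw [h₁, hn]; rfl)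
    exact ⟨m', .single h₃⟩
  | succ n ih =>
    obtain ⟨m', hm'⟩ := net.exists_Q_pos m
    obtain ⟨lc', la', h₁, -, h₃⟩ := exists_drop_step lc la hm'
    obtain ⟨a, ha⟩ := ih lc' la' m' (by omega)
    exact ⟨a, .head h₃ ha⟩

lemma reach_empty_of_irreducible (hirr : ChainIrreducible net.Q) (m m' : net.Mode) :
    Relation.ReflTransGen (fun a b => 0 < net.transZ a b) (0, 0, m) (0, 0, m') := by
  obtain ⟨n, hn⟩ := hirr m m'
  have hr := reflTransGen_of_pow_pos net.Q_nonneg hn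
  clear hn
  induction hr with
  | refl => exact .refl
  | tail _ hbc ih =>
    obtain ⟨lc', la', h₁, h₂, h₃⟩ := exists_drop_step (0 : Fin (net.capC + 1))
      (0 : Fin (min net.capA net.Nmax + 1)) hbc
    obtain rfl := h₂ rfl
    obtain rfl : la' = 0 := Fin.ext h₁
    exact ih.tail h₃

lemma V_nonneg (i j : net.EffState m₀) : 0 ≤ net.V m₀ i j := net.transZ_nonneg _ _

lemma sum_V_le_one (i : net.EffState m₀) : ∑ j, net.V m₀ i j ≤ 1 := by
  classical
  refine le_trans (Finset.sum_map Finset.univ (Function.Embedding.subtype _)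
    (net.transZ i.1)).ge ((Finset.sum_le_sum_of_subset_of_nonneg (Finset.subset_univ _)
      fun _ _ _ => net.transZ_nonneg _ _).trans (net.sum_transZ_le_one i.1))

/-- All visited states communicate: from each of them the chain can return to empty buffers, and
each of them has been reached from there. -/
lemma V_irreducible (hirr : ChainIrreducible net.Q) (s t : net.EffState m₀) :
    Relation.ReflTransGen (fun a b => 0 < net.V m₀ a b) s t := by
  obtain ⟨m, hm⟩ := exists_reach_empty s.1
  obtain ⟨m', -, ht⟩ := visited_iff.1 t.2
  have hst := (hm.trans (reach_empty_of_irreducible hirr m m')).trans ht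
  have key : ∀ u, Relation.ReflTransGen (fun a b => 0 < net.transZ a b) s.1 u →
      ∃ hu : net.Visited m₀ u, Relation.ReflTransGen (fun a b => 0 < net.V m₀ a b) s ⟨u, hu⟩ := by
    intro u hu
    induction hu with
    | refl => exact ⟨s.2, .refl⟩
    | tail _ hbc ih =>
      obtain ⟨hb, hr⟩ := ih
      exact ⟨hb.tail hbc, hr.tail hbc⟩
  exact (key t.1 hst).2

end Network

/-! ### The matrix `U` -/

namespace Network

variable {net : Network} {m₀ : net.Mode}

lemma D_nonneg (l : ℕ) (i j : net.OpenState m₀) : 0 ≤ net.D m₀ l i j :=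
  firstReturn_nonneg _ V_nonneg l i j

lemma summable_D (i j : net.OpenState m₀) : Summable fun l : ℕ => net.D m₀ (l + 1) i j :=
  summable_firstReturn _ V_nonneg sum_V_le_one i j

lemma Vtilde_nonneg (i j : net.OpenState m₀) : 0 ≤ net.Vtilde m₀ i j :=
  tsum_nonneg fun l => D_nonneg (l + 1) i j

/-- The support of `π` is closed under first returns, hence everything. -/
lemma stationaryDist_pos (hirr : ChainIrreducible net.Q) {π : net.OpenState m₀ → ℝ}
    (hπ : IsStationaryDist (net.Vtilde m₀) π) (i : net.OpenState m₀) : 0 < π i := by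
  obtain ⟨i₀, -, hi₀⟩ := Finset.exists_ne_zero_of_sum_ne_zero (hπ.sum_eq_one.trans_ne one_ne_zero)
  refine forall_of_firstReturn_closed (A := fun i => 0 < π i) _ V_nonneg (V_irreducible hirr)
    (fun l i j hi hD => ?_) ((hπ.nonneg i₀).lt_of_ne' hi₀) i
  cases l with
  | zero => exact absurd hD (lt_irrefl 0)
  | succ l =>
    have hV : 0 < net.Vtilde m₀ i j := hD.trans_le
      ((summable_D i j).le_tsum l fun k _ => D_nonneg (k + 1) i j)
    rw [← congrFun hπ.stationary j]
    exact Finset.sum_pos' (fun k _ => mul_nonneg (hπ.nonneg k) (Vtilde_nonneg k j))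
      ⟨i, Finset.mem_univ i, mul_pos hi hV⟩

section

variable {ρ : ℝ}

lemma tsum_pow_mul_D_nonneg (hρ₀ : 0 < ρ) (i j : net.OpenState m₀) :
    0 ≤ ∑' l : ℕ, ρ ^ (l + 1) * net.D m₀ (l + 1) i j :=
  tsum_nonneg fun l => mul_nonneg (pow_nonneg hρ₀.le _) (D_nonneg (l + 1) i j)

lemma r_nonneg (hρ₀ : 0 < ρ) (i j : net.OpenState m₀) : 0 ≤ net.r m₀ ρ i j :=
  div_nonneg (tsum_pow_mul_D_nonneg hρ₀ i j) (Vtilde_nonneg i j)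

lemma r_mul_Vtilde (hρ₀ : 0 < ρ) (hρ₁ : ρ < 1) (i j : net.OpenState m₀) :
    net.r m₀ ρ i j * net.Vtilde m₀ i j = ∑' l : ℕ, ρ ^ (l + 1) * net.D m₀ (l + 1) i j := by
  refine div_mul_cancel_of_imp fun h => le_antisymm ?_ (tsum_pow_mul_D_nonneg hρ₀ i j)
  rw [← h]
  exact (summable_pow_mul_firstReturn _ V_nonneg sum_V_le_one hρ₀.le hρ₁.le i j).tsum_le_tsum
    (fun l => mul_le_of_le_one_left (D_nonneg (l + 1) i j) (pow_le_one₀ hρ₀.le hρ₁.le))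
    (summable_D i j)

variable {π : net.OpenState m₀ → ℝ}

lemma F_apply (hπ : ∀ i, 0 < π i) (i j : net.OpenState m₀) :
    net.F m₀ π i j = π i * net.Vtilde m₀ i j / π j := by
  have h : (Matrix.diagonal π)⁻¹ = Matrix.diagonal fun i => (π i)⁻¹ := by
    refine Matrix.inv_eq_right_inv ?_
    rw [Matrix.diagonal_mul_diagonal, ← Matrix.diagonal_one]
    congr 1
    funext i
    exact mul_inv_cancel₀ (hπ i).ne'
  rw [F, h, Matrix.mul_diagonal, Matrix.diagonal_mul, div_eq_mul_inv]

lemma F_nonneg (hπ : ∀ i, 0 < π i) (i j : net.OpenState m₀) : 0 ≤ net.F m₀ π i j := by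
  rw [F_apply hπ]
  exact div_nonneg (mul_nonneg (hπ i).le (Vtilde_nonneg i j)) (hπ j).le

/-- The transpose of `F` is stochastic: it is the transition matrix of the time-reversed embedded
chain. -/
lemma sum_F (hπ : ∀ i, 0 < π i) (hst : Matrix.vecMul π (net.Vtilde m₀) = π)
    (j : net.OpenState m₀) : ∑ i, net.F m₀ π i j = 1 := by
  simp_rw [F_apply hπ, ← Finset.sum_div]
  rw [div_eq_one_iff_eq (hπ j).ne']
  exact congrFun hst j

lemma U_nonneg (hρ₀ : 0 < ρ) (hπ : ∀ i, 0 < π i) (a b : net.OpenState m₀ × net.OpenState m₀) :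
    0 ≤ net.U m₀ ρ π a b := by
  unfold U
  split_ifs
  · exact mul_nonneg (r_nonneg hρ₀ _ _) (F_nonneg hπ _ _)
  · exact le_rfl

/-- The row sums of `U` are entries of `r`. -/
lemma sum_U (hπ : ∀ i, 0 < π i) (hst : Matrix.vecMul π (net.Vtilde m₀) = π)
    (a : net.OpenState m₀ × net.OpenState m₀) :
    ∑ b, net.U m₀ ρ π a b = net.r m₀ ρ a.2 a.1 := by
  simp only [U, Fintype.sum_prod_type]
  rw [Finset.sum_eq_single a.2]
  · simp only [if_true]
    rw [← Finset.mul_sum, sum_F hπ hst, mul_one]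
  · intro b _ hb
    simp [hb]
  · simp

lemma lambdaMax_U_le (hρ₀ : 0 < ρ) (hπ : ∀ i, 0 < π i)
    (hst : Matrix.vecMul π (net.Vtilde m₀) = π) [Nonempty (net.OpenState m₀)] :
    lambdaMax (net.U m₀ ρ π) ≤ ⨆ p : net.OpenState m₀ × net.OpenState m₀, net.r m₀ ρ p.1 p.2 :=
  lambdaMax_le_of_sum_le (U_nonneg hρ₀ hπ) (Real.iSup_nonneg fun _ => r_nonneg hρ₀ _ _) fun a =>
    (sum_U hπ hst a).le.trans (le_ciSup (f := fun p : net.OpenState m₀ × net.OpenState m₀ =>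
      net.r m₀ ρ p.1 p.2) (Set.finite_range _).bddAbove (a.2, a.1))

/-- If `(α / ρ) λ_max(U) < 1`, then `h = C + (α / ρ) G h` has a nonnegative solution for the matrix
`G = ∑ l, ρ ^ l * D(l)` of the discounted embedded chain. It is obtained from a left fixed point `y`
of `U` through `g k = ∑ i, r k i * y (i, k)`: since `r k i * F k i = π k * G k i / π i`, this turns
the left fixed-point equation of `U` into a right one of `G`. -/
lemma exists_fixedPoint_of_lambdaMax_U (hρ₀ : 0 < ρ) (hρ₁ : ρ < 1) (hπ : ∀ i, 0 < π i)
    [Nonempty (net.OpenState m₀)] {α : ℝ} (hα : 0 < α)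
    (hU : α / ρ * lambdaMax (net.U m₀ ρ π) < 1) {C : ℝ} (hC : 0 ≤ C) :
    ∃ h : net.OpenState m₀ → ℝ, (∀ i, 0 ≤ h i) ∧ ∀ i, h i = C + α / ρ *
      ∑ j, (∑' l : ℕ, ρ ^ (l + 1) * net.D m₀ (l + 1) i j) * h j := by
  set β := α / ρ with hβ
  have hβ₀ : 0 < β := div_pos hα hρ₀
  obtain ⟨y, hy₀, hy⟩ := exists_nonneg_eq_add_smul_vecMul (U_nonneg hρ₀ hπ) hβ₀ hU
    (v := fun a => C * net.F m₀ π a.2 a.1 * π a.1)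
    (fun a => mul_nonneg (mul_nonneg hC (F_nonneg hπ _ _)) (hπ _).le)
  let g : net.OpenState m₀ → ℝ := fun k => ∑ i, net.r m₀ ρ k i * y (i, k)
  have hg₀ : ∀ k, 0 ≤ g k := fun k => Finset.sum_nonneg fun i _ =>
    mul_nonneg (r_nonneg hρ₀ _ _) (hy₀ _)
  have hy' : ∀ i k, y (i, k) = C * net.F m₀ π k i * π i + β * (net.F m₀ π k i * g i) := by
    intro i k
    rw [hy]
    congr 2
    simp only [U, Fintype.sum_prod_type, mul_ite, mul_zero, g, Finset.mul_sum]
    refine Finset.sum_congr rfl fun j _ => ?_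
    rw [Finset.sum_ite_eq Finset.univ i, if_pos (Finset.mem_univ _)]
    ring
  have hrF : ∀ k i, net.r m₀ ρ k i * net.F m₀ π k i
      = π k * (∑' l : ℕ, ρ ^ (l + 1) * net.D m₀ (l + 1) k i) / π i := by
    intro k i
    rw [F_apply hπ, ← r_mul_Vtilde hρ₀ hρ₁]
    ring
  refine ⟨fun k => C + β * (g k / π k), fun k => add_nonneg hC
    (mul_nonneg hβ₀.le (div_nonneg (hg₀ k) (hπ k).le)), fun k => ?_⟩
  dsimp only
  congr 2
  rw [div_eq_iff (hπ k).ne', Finset.sum_mul]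
  refine Finset.sum_congr rfl fun i _ => ?_
  rw [hy', mul_add, show net.r m₀ ρ k i * (C * net.F m₀ π k i * π i)
    = net.r m₀ ρ k i * net.F m₀ π k i * (C * π i) by ring,
    show net.r m₀ ρ k i * (β * (net.F m₀ π k i * g i))
    = net.r m₀ ρ k i * net.F m₀ π k i * (β * g i) by ring, hrF]
  have := (hπ i).ne'
  field_simp

lemma exists_supersolution_V (hρ₀ : 0 < ρ) (hρ₁ : ρ < 1) (hπ : ∀ i, 0 < π i)
    [Nonempty (net.OpenState m₀)] {α : ℝ} (hα : 0 < α)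
    (hU : α / ρ * lambdaMax (net.U m₀ ρ π) < 1) :
    ∃ h : net.EffState m₀ → ℝ, (∀ s, 0 ≤ h s) ∧ ∀ s,
      1 + (if net.ActuatorEmpty m₀ s then α else ρ) * ∑ t, net.V m₀ s t * h t ≤ h s := by
  obtain ⟨C, hC, hex⟩ := exists_supersolution (net.ActuatorEmpty m₀) (V_nonneg (net := net))
    sum_V_le_one hρ₀ hρ₁ hα
  obtain ⟨h₀, hh₀, heq⟩ := exists_fixedPoint_of_lambdaMax_U hρ₀ hρ₁ hπ hα hU hC
  exact hex h₀ hh₀ heq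

end

end Network

/-! ### Buffer contents and the Lyapunov function along a trajectory -/

section Plant

variable {E : Type*} [Zero E]

lemma bufEntry_of_lt {k : ℕ} (b : ℕ → E) {i : ℕ} (h : i < k) :
    bufEntry (fun j : Fin k => b j) i = b i := dif_pos h

lemma bufEntry_bufShift {k : ℕ} (b : Fin k → E) (i : ℕ) :
    bufEntry (bufShift b) i = bufEntry b (i + 1) := by
  by_cases h : i < k
  · exact bufEntry_of_lt (fun j => bufEntry b (j + 1)) h
  · rw [bufEntry, bufEntry, dif_neg h, dif_neg (by omega)]

lemma bufEntry_bufShift_iterate {k : ℕ} (L : ℕ) (b : Fin k → E) (i : ℕ) :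
    bufEntry (bufShift^[L] b) i = bufEntry b (i + L) := by
  induction L generalizing b with
  | zero => rfl
  | succ L ih => rw [Function.iterate_succ_apply, ih, bufEntry_bufShift, add_assoc]

lemma bufEntry_zero {k : ℕ} (i : ℕ) : bufEntry (fun _ : Fin k => (0 : E)) i = 0 := by
  unfold bufEntry; split_ifs <;> rfl

variable {X : Type*} (net : Network) (f : X → E → X) (κ : X → E)

/-- The buffers hold the commands predicted from the present plant state: the first `λ_a` in the
actuator's buffer, which is zero beyond them, and, unless `λ_a = 0`, the next `λ_c` in the
controller's buffer. -/
structure BuffersPredict (s : LoopState net X E) : Prop where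
  lenBound : net.LenBound s.len
  ba_eq : ∀ i < s.len.2, bufEntry s.ba i = tentative f κ s.x i
  ba_zero : ∀ i, s.len.2 ≤ i → bufEntry s.ba i = 0
  bc_eq : s.len.2 ≠ 0 → ∀ i < s.len.1, bufEntry s.bc i = tentative f κ s.x (s.len.2 + i)

variable {net f κ}

lemma BuffersPredict.input_of_eq_zero {s : LoopState net X E} (hs : BuffersPredict net f κ s)
    (h : s.len.2 = 0) : s.input = 0 := hs.ba_zero 0 h.le

lemma BuffersPredict.input_of_ne_zero {s : LoopState net X E} (hs : BuffersPredict net f κ s)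
    (h : s.len.2 ≠ 0) : s.input = κ s.x := hs.ba_eq 0 (Nat.pos_of_ne_zero h)

lemma tentative_succ {X E : Type*} {f : X → E → X} {κ : X → E} (x : X) (i : ℕ) :
    tentative f κ x (i + 1) = tentative f κ (f x (κ x)) i :=
  congrArg κ (Function.iterate_succ_apply _ i x)

lemma BuffersPredict.loopStep {s : LoopState net X E} (hs : BuffersPredict net f κ s)
    (m : net.Mode) (c c' : Bool) : BuffersPredict net f κ (loopStep net f κ m c c' s) := by
  have hlen : (_root_.loopStep net f κ m c c' s).len = net.lenStep m c c' s.len := rfl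
  have hb := hs.lenBound.lenStep m c c'
  have hx : s.len.2 ≠ 0 → (_root_.loopStep net f κ m c c' s).x = f s.x (κ s.x) := fun h =>
    congrArg (f s.x) (hs.input_of_ne_zero h)
  have hcap := net.capA_le
  have hNc := net.Nmax_le
  have hmN : (m.2.2 : ℕ) ≤ net.Nmax := Nat.lt_succ_iff.1 m.2.2.2
  obtain ⟨hb₁, hb₂⟩ := hs.lenBound
  set s' := _root_.loopStep net f κ m c c' s with hs'
  set L := net.numSent m c' s.len with hL
  cases c with
  | false =>
    have hba : s'.ba = bufShift s.ba := by simp [hs', _root_.loopStep]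
    have h₂ : s'.len.2 = s.len.2 - 1 := by rw [hlen]; simp [Network.lenStep]
    refine ⟨hb, fun i hi => ?_, fun i hi => ?_, fun h i hi => ?_⟩
    · rw [hba, bufEntry_bufShift, hs.ba_eq _ (by omega), hx (by omega), tentative_succ]
    · rw [hba, bufEntry_bufShift, hs.ba_zero _ (by omega)]
    · have hne : s.len.2 ≠ 0 := by omega
      by_cases hnew : net.HasNew m c'
      · exact absurd hi (by rw [hlen]; simp [Network.lenStep, hnew])
      · have h₁ : s'.len.1 = s.len.1 := by rw [hlen]; simp [Network.lenStep, hnew, hne]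
        have hbc : s'.bc = s.bc := by simp [hs', _root_.loopStep, hnew, hne]
        rw [hbc, hs.bc_eq hne i (by omega), hx hne, ← tentative_succ]
        congr 1
        omega
  | true =>
    by_cases hnew : net.HasNew m c'
    · obtain ⟨hL₁, hL₂⟩ := net.numSent_le_of_hasNew m c' s.len hnew
      have h₁ : s'.len.1 = m.2.2 - L := by rw [hlen]; simp [Network.lenStep, hnew, hL]
      have h₂ : s'.len.2 = L := by rw [hlen]; simp [Network.lenStep, hnew, hL]
      have hba : s'.ba = fun i : Fin net.capA =>
          if (i : ℕ) < L then tentative f κ s'.x i else 0 := by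
        simp [hs', _root_.loopStep, hnew, hL]
      have hbc : s'.bc = bufShift^[L] (fun i : Fin net.capC =>
          if (i : ℕ) < (m.2.2 : ℕ) then tentative f κ s'.x i else 0) := by
        simp [hs', _root_.loopStep, hnew, hL]
      refine ⟨hb, fun i hi => ?_, fun i hi => ?_, fun h i hi => ?_⟩
      · rw [hba, bufEntry_of_lt (fun j => if j < L then tentative f κ s'.x j else 0) (by omega),
          if_pos (by omega)]
      · rw [hba, bufEntry]
        dsimp only
        split_ifs
        · omega
        · rfl
        · rfl
      · rw [hbc, bufEntry_bufShift_iterate,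
          bufEntry_of_lt (fun j => if j < (m.2.2 : ℕ) then tentative f κ s'.x j else 0) (by omega),
          if_pos (by omega), h₂, add_comm]
    · have hL₁ := net.numSent_le_fst m c' s.len hnew
      have hL₂ := net.numSent_le_sub m c' s.len hnew
      by_cases h0 : s.len.2 = 0
      · have h₂ : s'.len.2 = 0 := by rw [hlen]; simp [Network.lenStep, hnew, h0]
        have hba : s'.ba = fun _ => 0 := by simp [hs', _root_.loopStep, hnew, h0]
        refine ⟨hb, fun i hi => by omega, fun i _ => ?_, fun h => absurd h₂ h⟩
        rw [hba, bufEntry_zero]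
      · have h₁ : s'.len.1 = s.len.1 - L := by rw [hlen]; simp [Network.lenStep, hnew, h0, hL]
        have h₂ : s'.len.2 = s.len.2 + L - 1 := by rw [hlen]; simp [Network.lenStep, hnew, h0, hL]
        have hba : s'.ba = fun i : Fin net.capA =>
            if (i : ℕ) < s.len.2 - 1 then bufEntry s.ba ((i : ℕ) + 1)
            else if (i : ℕ) < s.len.2 - 1 + L then bufEntry s.bc ((i : ℕ) - (s.len.2 - 1))
            else 0 := by
          simp [hs', _root_.loopStep, hnew, h0, hL]
        have hbc : s'.bc = bufShift^[L] s.bc := by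
          simp [hs', _root_.loopStep, hnew, h0, hL]
        refine ⟨hb, fun i hi => ?_, fun i hi => ?_, fun h i hi => ?_⟩
        · rw [hba, bufEntry_of_lt (fun i => if i < s.len.2 - 1 then bufEntry s.ba (i + 1)
            else if i < s.len.2 - 1 + L then bufEntry s.bc (i - (s.len.2 - 1)) else 0)
            (by omega), hx h0, ← tentative_succ]
          split_ifs with hi₁ hi₂
          · exact hs.ba_eq _ (by omega)
          · rw [hs.bc_eq h0 _ (by omega)]
            congr 1
            omega
          · omega
        · rw [hba, bufEntry]
          dsimp only
          split_ifs
          · omega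
          · omega
          · rfl
          · rfl
        · rw [hbc, bufEntry_bufShift_iterate, hs.bc_eq h0 _ (by omega), hx h0, ← tentative_succ]
          congr 1
          omega

lemma buffersPredict_closedLoop (m : ℕ → net.Mode) (c c' : ℕ → Bool) (x₀ : X) (t : ℕ) :
    BuffersPredict net f κ (closedLoop net f κ m c c' x₀ t) := by
  induction t with
  | zero =>
    exact ⟨⟨Nat.zero_le _, Nat.zero_le _⟩, fun i hi => absurd hi (Nat.not_lt_zero i),
      fun i _ => bufEntry_zero i, fun h => absurd rfl h⟩
  | succ t ih => exact ih.loopStep _ _ _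

end Plant

namespace Network

variable (net : Network)

/-- The present mode `(B, B', N)` and the outcomes of the controller-actuator and of the
sensor-controller transmission. -/
abbrev Outcome : Type := net.Mode × Bool × Bool

/-- The effective buffer lengths at time `t` along a realization of the network. -/
def lenPath (ξ : ℕ → net.Outcome) : ℕ → ℕ × ℕ
  | 0 => (0, 0)
  | t + 1 => net.lenStep (ξ (t + 1)).1 (ξ (t + 1)).2.1 (ξ (t + 1)).2.2 (lenPath ξ t)

/-- The bound for the growth of the Lyapunov function in one step from a state with the given buffer
lengths: `α` in open loop, `ρ` in closed loop. -/
noncomputable def growth (α ρ : ℝ≥0∞) (l : ℕ × ℕ) : ℝ≥0∞ := if l.2 = 0 then α else ρ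

/-- The bound for the growth of the Lyapunov function up to time `t`. -/
noncomputable def growthPath (α ρ : ℝ≥0∞) (ξ : ℕ → net.Outcome) (t : ℕ) : ℝ≥0∞ :=
  ∏ k ∈ Finset.range t, growth α ρ (net.lenPath ξ k)

variable {net}

lemma lenPath_congr {ξ ξ' : ℕ → net.Outcome} {t : ℕ} (h : ∀ k ≤ t, ξ k = ξ' k) :
    net.lenPath ξ t = net.lenPath ξ' t := by
  induction t with
  | zero => rfl
  | succ t ih => rw [lenPath, lenPath, ih fun k hk => h k (by omega), h _ le_rfl]

lemma growthPath_congr (α ρ : ℝ≥0∞) {ξ ξ' : ℕ → net.Outcome} {t : ℕ} (h : ∀ k < t, ξ k = ξ' k) :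
    net.growthPath α ρ ξ t = net.growthPath α ρ ξ' t :=
  Finset.prod_congr rfl fun k hk => by
    rw [lenPath_congr fun j hj => h j (hj.trans_lt (Finset.mem_range.1 hk))]

end Network

section Lyapunov

variable {X E : Type*} [Zero E] {net : Network} {f : X → E → X} {κ : X → E}

lemma closedLoop_len (ξ : ℕ → net.Outcome) (x₀ : X) (t : ℕ) :
    (closedLoop net f κ (fun k => (ξ k).1) (fun k => (ξ k).2.1) (fun k => (ξ k).2.2) x₀ t).len
      = net.lenPath ξ t := by
  induction t with
  | zero => rfl
  | succ t ih => rw [Network.lenPath, ← ih]; rfl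

lemma lyapunov_closedLoop_le {W : X → ℝ≥0} {ρ α : ℝ}
    (hclosed : ∀ x, (W (f x (κ x)) : ℝ) ≤ ρ * W x) (hopen : ∀ x, (W (f x 0) : ℝ) ≤ α * W x)
    (ξ : ℕ → net.Outcome) (x₀ : X) (t : ℕ) :
    (W (closedLoop net f κ (fun k => (ξ k).1) (fun k => (ξ k).2.1) (fun k => (ξ k).2.2) x₀ t).x
      : ℝ≥0∞) ≤ net.growthPath (ENNReal.ofReal α) (ENNReal.ofReal ρ) ξ t * W x₀ := by
  have hcast : ∀ (a : ℝ) (w w' : ℝ≥0), (w : ℝ) ≤ a * w' →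
      (w : ℝ≥0∞) ≤ ENNReal.ofReal a * w' := fun a w w' h => by
    rw [← ENNReal.ofReal_coe_nnreal, ← ENNReal.ofReal_coe_nnreal,
      ← ENNReal.ofReal_mul' w'.coe_nonneg]
    exact ENNReal.ofReal_le_ofReal h
  induction t with
  | zero => simp [Network.growthPath, closedLoop]
  | succ t ih =>
    set s := closedLoop net f κ (fun k => (ξ k).1) (fun k => (ξ k).2.1) (fun k => (ξ k).2.2) x₀ t
      with hs
    have hp : BuffersPredict net f κ s := buffersPredict_closedLoop _ _ _ x₀ t
    have hlen : s.len = net.lenPath ξ t := closedLoop_len ξ x₀ t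
    have hstep : (W (f s.x s.input) : ℝ≥0∞) ≤
        Network.growth (ENNReal.ofReal α) (ENNReal.ofReal ρ) (net.lenPath ξ t) * W s.x := by
      rw [← hlen, Network.growth]
      split_ifs with h
      · rw [hp.input_of_eq_zero h]
        exact hcast _ _ _ (hopen s.x)
      · rw [hp.input_of_ne_zero h]
        exact hcast _ _ _ (hclosed s.x)
    refine hstep.trans ?_
    rw [Network.growthPath, Finset.prod_range_succ, mul_comm _ (Network.growth _ _ _), mul_assoc]
    exact mul_le_mul_right ih _

end Lyapunov

/-! ### Expected growth of the Lyapunov function -/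

lemma lintegral_comp_of_fintype {Ω β : Type*} [MeasurableSpace Ω] {μ : Measure Ω} [Fintype β]
    [MeasurableSpace β] [DiscreteMeasurableSpace β] (f : β → ℝ≥0∞) {Y : Ω → β} (hY : Measurable Y) :
    ∫⁻ ω, f (Y ω) ∂μ = ∑ a, f a * μ (Y ⁻¹' {a}) := by
  rw [← lintegral_map Measurable.of_discrete hY, lintegral_fintype]
  exact Finset.sum_congr rfl fun a _ => by rw [Measure.map_apply hY (measurableSet_singleton _)]

namespace Network

variable {net : Network} {m₀ : net.Mode}

/-- The probability of the next outcome, given the present mode. -/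
def outcomeProb (net : Network) (a : net.Mode) (y : net.Outcome) : ℝ :=
  net.Q a y.1 * (net.probCA y.2.1 * net.probSC y.1 y.2.2)

lemma outcomeProb_nonneg (a : net.Mode) (y : net.Outcome) : 0 ≤ net.outcomeProb a y :=
  mul_nonneg (net.Q_nonneg _ _) (mul_nonneg (net.probCA_nonneg _) (net.probSC_nonneg _ _))

section Outcomes

variable {Ω : Type*} [MeasurableSpace Ω] {μ : Measure Ω}

lemma IsNetworkProcess.measurable {m : ℕ → Ω → net.Mode} {γ γ' : ℕ → Ω → Bool}
    (h : net.IsNetworkProcess m₀ μ m γ γ') :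
    Measurable (fun ω (t : ℕ) => (m t ω, γ t ω, γ' t ω)) :=
  measurable_pi_lambda _ fun t =>
    (h.measurable_m t).prodMk ((h.measurable_γ t).prodMk (h.measurable_γ' t))

variable {ξ : Ω → ℕ → net.Outcome}

lemma IsNetworkProcess.measure_path_succ
    (h : net.IsNetworkProcess m₀ μ (fun t ω => (ξ ω t).1) (fun t ω => (ξ ω t).2.1)
      (fun t ω => (ξ ω t).2.2)) (T : ℕ) (b : ℕ → net.Outcome) :
    μ {ω | ∀ t ≤ T + 1, ξ ω t = b t} =
      μ {ω | ∀ t ≤ T, ξ ω t = b t} * ENNReal.ofReal (net.outcomeProb (b T).1 (b (T + 1))) := by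
  have key : ∀ T, μ {ω | ∀ t ≤ T, ξ ω t = b t} = _ := fun T => by
    simpa only [Prod.ext_iff] using h.law T (fun t => (b t).1) (fun t => (b t).2.1)
      (fun t => (b t).2.2)
  rw [key, key, ← ENNReal.ofReal_mul' (outcomeProb_nonneg _ _)]
  congr 1
  rw [Finset.prod_range_succ, Finset.prod_range_succ _ (T + 1), outcomeProb]
  ring

/-- The Markov property, for functionals of the path up to time `T` and of the next outcome. -/
lemma IsNetworkProcess.lintegral_next
    (h : net.IsNetworkProcess m₀ μ (fun t ω => (ξ ω t).1) (fun t ω => (ξ ω t).2.1)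
      (fun t ω => (ξ ω t).2.2)) (T : ℕ) (Φ : (ℕ → net.Outcome) → net.Outcome → ℝ≥0∞)
    (hΦ : ∀ b b' y, (∀ k ≤ T, b k = b' k) → Φ b y = Φ b' y) :
    ∫⁻ ω, Φ (ξ ω) (ξ ω (T + 1)) ∂μ =
      ∫⁻ ω, ∑ y, ENNReal.ofReal (net.outcomeProb (ξ ω T).1 y) * Φ (ξ ω) y ∂μ := by
  have hξ : ∀ t, Measurable fun ω => ξ ω t := fun t => measurable_pi_iff.1 h.measurable t
  -- Restriction of a path to the times up to `T`, and a right inverse.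
  let Y : Ω → Fin (T + 1) → net.Outcome := fun ω i => ξ ω i
  let e : (Fin (T + 1) → net.Outcome) → net.Outcome → ℕ → net.Outcome := fun a y k =>
    if hk : k < T + 1 then a ⟨k, hk⟩ else y
  have hY : Measurable Y := measurable_pi_lambda _ fun i => hξ i
  have heY : ∀ ω y, ∀ k ≤ T, e (Y ω) y k = ξ ω k := fun ω y k hk => dif_pos (by omega)
  have heT : ∀ a y, e a y (T + 1) = y := fun a y => dif_neg (by omega)
  have hpre : ∀ a y, Y ⁻¹' {a} = {ω | ∀ t ≤ T, ξ ω t = e a y t} := by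
    intro a y
    ext ω
    simp only [Set.mem_preimage, Set.mem_singleton_iff, Set.mem_ofPred_eq]
    constructor
    · rintro rfl t ht
      exact (heY ω y t ht).symm
    · intro H
      funext i
      exact (H i (by omega)).trans (dif_pos i.2)
  have hpre' : ∀ a y, (fun ω => (Y ω, ξ ω (T + 1))) ⁻¹' {(a, y)}
      = {ω | ∀ t ≤ T + 1, ξ ω t = e a y t} := by
    intro a y
    ext ω
    have h₁ := Set.ext_iff.1 (hpre a y) ω
    simp only [Set.mem_preimage, Set.mem_singleton_iff, Set.mem_ofPred_eq] at h₁
    simp only [Set.mem_preimage, Set.mem_singleton_iff, Set.mem_ofPred_eq, Prod.mk.injEq, h₁]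
    constructor
    · rintro ⟨H, H'⟩ t ht
      rcases Nat.le_succ_iff.1 ht with ht | rfl
      · exact H t ht
      · rw [H', heT]
    · intro H
      exact ⟨fun t ht => H t (by omega), (H _ le_rfl).trans (heT a y)⟩
  let y₀ : net.Outcome := (m₀, true, true)
  have hL : ∫⁻ ω, Φ (ξ ω) (ξ ω (T + 1)) ∂μ
      = ∑ a, ∑ y, Φ (e a y₀) y * μ {ω | ∀ t ≤ T + 1, ξ ω t = e a y t} := by
    have h₁ : ∀ ω, Φ (ξ ω) (ξ ω (T + 1))
        = (fun z : (Fin (T + 1) → net.Outcome) × net.Outcome => Φ (e z.1 y₀) z.2)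
          (Y ω, ξ ω (T + 1)) := fun ω => hΦ _ _ _ fun k hk => (heY ω y₀ k hk).symm
    rw [lintegral_congr h₁]
    refine (lintegral_comp_of_fintype (fun z : (Fin (T + 1) → net.Outcome) × net.Outcome =>
      Φ (e z.1 y₀) z.2) (hY.prodMk (hξ (T + 1)))).trans ?_
    rw [Fintype.sum_prod_type]
    exact Finset.sum_congr rfl fun a _ => Finset.sum_congr rfl fun y _ => by rw [hpre']
  have hR : ∫⁻ ω, ∑ y, ENNReal.ofReal (net.outcomeProb (ξ ω T).1 y) * Φ (ξ ω) y ∂μ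
      = ∑ a, (∑ y, ENNReal.ofReal (net.outcomeProb (e a y₀ T).1 y) * Φ (e a y₀) y)
        * μ (Y ⁻¹' {a}) := by
    have h₁ : ∀ ω, ∑ y, ENNReal.ofReal (net.outcomeProb (ξ ω T).1 y) * Φ (ξ ω) y
        = (fun a => ∑ y, ENNReal.ofReal (net.outcomeProb (e a y₀ T).1 y) * Φ (e a y₀) y)
          (Y ω) := fun ω => Finset.sum_congr rfl fun y _ => by
      rw [heY ω y₀ T le_rfl, hΦ _ _ y fun k hk => (heY ω y₀ k hk).symm]
    rw [lintegral_congr h₁]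
    exact lintegral_comp_of_fintype
      (fun a => ∑ y, ENNReal.ofReal (net.outcomeProb (e a y₀ T).1 y) * Φ (e a y₀) y) hY
  rw [hL, hR]
  refine Finset.sum_congr rfl fun a _ => ?_
  rw [Finset.sum_mul]
  refine Finset.sum_congr rfl fun y _ => ?_
  have heaT : e a y₀ T = e a y T := by simp [e]
  rw [h.measure_path_succ, heT, ← hpre, heaT]
  ring

/-- The mode at time `0` is `m₀` almost surely. -/
lemma IsNetworkProcess.lintegral_zero_lt_top
    (h : net.IsNetworkProcess m₀ μ (fun t ω => (ξ ω t).1) (fun t ω => (ξ ω t).2.1)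
      (fun t ω => (ξ ω t).2.2)) [IsProbabilityMeasure μ] {φ : net.Mode → ℝ≥0∞} (hφ : φ m₀ < ⊤) :
    ∫⁻ ω, φ (ξ ω 0).1 ∂μ < ⊤ := by
  have hξ : Measurable fun ω => ξ ω 0 := measurable_pi_iff.1 h.measurable 0
  rw [lintegral_comp_of_fintype (fun y : net.Outcome => φ y.1) hξ]
  refine ENNReal.sum_lt_top.2 fun y _ => ?_
  by_cases hy : y.1 = m₀
  · rw [hy]
    exact ENNReal.mul_lt_top hφ (measure_lt_top μ _)
  · have h₀ : μ ((fun ω => ξ ω 0) ⁻¹' {y}) = 0 := by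
      have := h.law 0 (fun _ => y.1) (fun _ => y.2.1) (fun _ => y.2.2)
      simpa [hy, ← Prod.ext_iff, Set.preimage] using this
    rw [h₀, mul_zero]
    exact ENNReal.zero_lt_top

end Outcomes

lemma measurable_lenPath (t : ℕ) : Measurable fun ξ : ℕ → net.Outcome => net.lenPath ξ t := by
  induction t with
  | zero => exact measurable_const
  | succ t ih =>
    exact (Measurable.of_discrete (f := fun z : net.Outcome × (ℕ × ℕ) =>
      net.lenStep z.1.1 z.1.2.1 z.1.2.2 z.2)).comp ((measurable_pi_apply (t + 1)).prodMk ih)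

lemma measurable_growthPath (α ρ : ℝ≥0∞) (t : ℕ) :
    Measurable fun ξ : ℕ → net.Outcome => net.growthPath α ρ ξ t :=
  Finset.measurable_fun_prod _ fun k _ =>
    (Measurable.of_discrete (f := growth α ρ)).comp (measurable_lenPath k)

open Classical in
/-- Extension of a function on the effective state space of `Z` to all pairs of buffer lengths and
mode, with the value `⊤` at the pairs that are not visited, for which `1 + c V h ≤ h` thus becomes
trivial. -/
noncomputable def extendTop (h : net.EffState m₀ → ℝ) (l : ℕ × ℕ) (a : net.Mode) : ℝ≥0∞ :=
  if hs : ∃ s : net.EffState m₀, net.lens s.1 = l ∧ s.1.2.2 = a then ENNReal.ofReal (h hs.choose)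
  else ⊤

lemma extendTop_eq (h : net.EffState m₀ → ℝ) (s : net.EffState m₀) :
    extendTop h (net.lens s.1) s.1.2.2 = ENNReal.ofReal (h s) := by
  have hs : ∃ t : net.EffState m₀, net.lens t.1 = net.lens s.1 ∧ t.1.2.2 = s.1.2.2 :=
    ⟨s, rfl, rfl⟩
  rw [extendTop, dif_pos hs]
  congr 2
  exact Subtype.ext (net.state_ext hs.choose_spec.1 hs.choose_spec.2)

lemma extendTop_eq_top (h : net.EffState m₀ → ℝ) {l : ℕ × ℕ} {a : net.Mode}
    (hs : ¬ ∃ s : net.EffState m₀, net.lens s.1 = l ∧ s.1.2.2 = a) : extendTop h l a = ⊤ :=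
  dif_neg hs

/-- The mean of `extendTop h l` over the next mode. -/
noncomputable def meanNext (h : net.EffState m₀ → ℝ) (l : ℕ × ℕ) (a : net.Mode) : ℝ≥0∞ :=
  ∑ b, ENNReal.ofReal (net.Q a b) * extendTop h l b

/-- The expectation of `meanNext h` over the two transmissions of a step with mode `a` is bounded by
the expectation of `h` after a step of `Z`. -/
lemma sum_meanNext_le {h : net.EffState m₀ → ℝ} (hh : ∀ s, 0 ≤ h s) (s : net.EffState m₀) :
    ∑ c, ∑ c', ENNReal.ofReal (net.probCA c * net.probSC s.1.2.2 c') *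
      meanNext h (net.lenStep s.1.2.2 c c' (net.lens s.1)) s.1.2.2 ≤
      ENNReal.ofReal (∑ t, net.V m₀ s t * h t) := by
  have hpp : ∀ c c', 0 ≤ net.probCA c * net.probSC s.1.2.2 c' := fun c c' =>
    mul_nonneg (net.probCA_nonneg c) (net.probSC_nonneg _ c')
  -- the contribution of a pair of transmission outcomes to a summand of `V h`
  let w : Bool → Bool → net.EffState m₀ → ℝ := fun c c' t =>
    net.probCA c * net.probSC s.1.2.2 c' * (net.Q s.1.2.2 t.1.2.2 *
      ((if net.lenStep s.1.2.2 c c' ((s.1.1 : ℕ), (s.1.2.1 : ℕ)) = ((t.1.1 : ℕ), (t.1.2.1 : ℕ))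
        then 1 else 0) * h t))
  have hw : ∀ c c' t, 0 ≤ w c c' t := fun c c' t => mul_nonneg (hpp c c')
    (mul_nonneg (net.Q_nonneg _ _) (mul_nonneg (by split_ifs <;> norm_num) (hh t)))
  have e₁ : ∑ t, net.V m₀ s t * h t = ∑ c, ∑ c', ∑ t, w c c' t := by
    simp only [V, transZ, Finset.mul_sum, Finset.sum_mul]
    rw [Finset.sum_comm]
    refine Finset.sum_congr rfl fun c _ => ?_
    rw [Finset.sum_comm]
    exact Finset.sum_congr rfl fun c' _ => Finset.sum_congr rfl fun t _ => by
      simp only [w]; ring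
  rw [e₁, ENNReal.ofReal_sum_of_nonneg fun c _ => Finset.sum_nonneg fun c' _ =>
    Finset.sum_nonneg fun t _ => hw c c' t]
  refine Finset.sum_le_sum fun c _ => ?_
  rw [ENNReal.ofReal_sum_of_nonneg fun c' _ => Finset.sum_nonneg fun t _ => hw c c' t]
  refine Finset.sum_le_sum fun c' _ => ?_
  rw [ENNReal.ofReal_sum_of_nonneg fun t _ => hw c c' t, meanNext, Finset.mul_sum,
    ← Finset.sum_fiberwise Finset.univ (fun t : net.EffState m₀ => t.1.2.2)]
  refine Finset.sum_le_sum fun b _ => ?_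
  rcases (hpp c c').eq_or_lt with h₀ | h₀
  · simp [← h₀]
  rcases (net.Q_nonneg s.1.2.2 b).eq_or_lt with hQ | hQ
  · simp [← hQ]
  -- both weights are positive, so that the next state is visited
  obtain ⟨t, ht, rfl⟩ := net.exists_state_of_lenBound (s.2.lenBound.lenStep s.1.2.2 c c') b
  have hpos : 0 < net.transZ s.1 t := net.transZ_pos_iff.2 ⟨hQ, c, c',
    (net.probCA_nonneg c).lt_of_ne' (left_ne_zero_of_mul h₀.ne'),
    (net.probSC_nonneg _ c').lt_of_ne' (right_ne_zero_of_mul h₀.ne'), ht.symm⟩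
  have hmem : (⟨t, s.2.tail hpos⟩ : net.EffState m₀) ∈
      Finset.univ.filter fun u : net.EffState m₀ => u.1.2.2 = t.2.2 := by simp
  refine le_trans (le_of_eq ?_) (Finset.single_le_sum (f := fun t => ENNReal.ofReal (w c c' t))
    (fun _ _ => zero_le) hmem)
  have hx := extendTop_eq h ⟨t, s.2.tail hpos⟩
  rw [← ht, hx, ← ENNReal.ofReal_mul (net.Q_nonneg _ _), ← ENNReal.ofReal_mul (hpp c c')]
  simp only [w]
  rw [if_pos (by exact ht.symm), one_mul]

section Growth

variable {α ρ : ℝ} {h : net.EffState m₀ → ℝ}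

lemma one_add_growth_mul_le (hα : 0 ≤ α) (hρ : 0 ≤ ρ) (hh : ∀ s, 0 ≤ h s)
    (hsup : ∀ s, 1 + (if net.ActuatorEmpty m₀ s then α else ρ) * ∑ t, net.V m₀ s t * h t ≤ h s)
    (l : ℕ × ℕ) (a : net.Mode) :
    1 + growth (ENNReal.ofReal α) (ENNReal.ofReal ρ) l *
      ∑ c, ∑ c', ENNReal.ofReal (net.probCA c * net.probSC a c') *
        meanNext h (net.lenStep a c c' l) a ≤ extendTop h l a := by
  by_cases hs : ∃ s : net.EffState m₀, net.lens s.1 = l ∧ s.1.2.2 = a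
  · obtain ⟨s, rfl, rfl⟩ := hs
    rw [extendTop_eq]
    refine le_trans ?_ (ENNReal.ofReal_le_ofReal (hsup s))
    have hw : 0 ≤ (if net.ActuatorEmpty m₀ s then α else ρ) := by split_ifs <;> assumption
    rw [ENNReal.ofReal_add zero_le_one (mul_nonneg hw (Finset.sum_nonneg fun t _ =>
      mul_nonneg (V_nonneg s t) (hh t))), ENNReal.ofReal_mul hw, ENNReal.ofReal_one]
    have hg : growth (ENNReal.ofReal α) (ENNReal.ofReal ρ) (net.lens s.1)
        = ENNReal.ofReal (if net.ActuatorEmpty m₀ s then α else ρ) := by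
      rw [apply_ite ENNReal.ofReal]
      rfl
    rw [hg]
    gcongr
    exact sum_meanNext_le hh s
  · rw [extendTop_eq_top h hs]
    exact le_top

lemma sum_ofReal_Q (a : net.Mode) : ∑ b, ENNReal.ofReal (net.Q a b) = 1 := by
  rw [← ENNReal.ofReal_sum_of_nonneg fun b _ => net.Q_nonneg a b, net.Q_sum, ENNReal.ofReal_one]

lemma one_add_growth_mul_sum_outcome_le (hα : 0 ≤ α) (hρ : 0 ≤ ρ) (hh : ∀ s, 0 ≤ h s)
    (hsup : ∀ s, 1 + (if net.ActuatorEmpty m₀ s then α else ρ) * ∑ t, net.V m₀ s t * h t ≤ h s)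
    (l : ℕ × ℕ) (a : net.Mode) :
    1 + growth (ENNReal.ofReal α) (ENNReal.ofReal ρ) l *
      ∑ y : net.Outcome, ENNReal.ofReal (net.outcomeProb a y) *
        meanNext h (net.lenStep y.1 y.2.1 y.2.2 l) y.1 ≤ meanNext h l a := by
  refine le_trans (le_of_eq ?_) (Finset.sum_le_sum fun b _ =>
    mul_le_mul_right (one_add_growth_mul_le hα hρ hh hsup l b) (ENNReal.ofReal (net.Q a b)))
  simp_rw [mul_add, mul_one]
  rw [Finset.sum_add_distrib, sum_ofReal_Q]
  congr 1
  simp_rw [Fintype.sum_prod_type, Finset.mul_sum, outcomeProb]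
  refine Finset.sum_congr rfl fun b _ => Finset.sum_congr rfl fun b' _ =>
    Finset.sum_congr rfl fun n _ => Finset.sum_congr rfl fun c _ =>
      Finset.sum_congr rfl fun c' _ => ?_
  rw [ENNReal.ofReal_mul (net.Q_nonneg a _)]
  ring

/-- The expected growth factors are summable: in each step, `growthPath * meanNext h` decreases in
mean by at least the mean of `growthPath`, and it is finite at the start. -/
lemma IsNetworkProcess.tsum_lintegral_growthPath_lt_top {Ω : Type*} [MeasurableSpace Ω]
    {μ : Measure Ω} [IsProbabilityMeasure μ] {ξ : Ω → ℕ → net.Outcome}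
    (hP : net.IsNetworkProcess m₀ μ (fun t ω => (ξ ω t).1) (fun t ω => (ξ ω t).2.1)
      (fun t ω => (ξ ω t).2.2))
    (hα : 0 ≤ α) (hρ : 0 ≤ ρ) (hh : ∀ s, 0 ≤ h s)
    (hsup : ∀ s, 1 + (if net.ActuatorEmpty m₀ s then α else ρ) * ∑ t, net.V m₀ s t * h t ≤ h s) :
    ∑' t, ∫⁻ ω, net.growthPath (ENNReal.ofReal α) (ENNReal.ofReal ρ) (ξ ω) t ∂μ < ⊤ := by
  set g := net.growthPath (ENNReal.ofReal α) (ENNReal.ofReal ρ) with hg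
  let J : ℕ → ℝ≥0∞ := fun t => ∫⁻ ω, g (ξ ω) t * meanNext h (net.lenPath (ξ ω) t) (ξ ω t).1 ∂μ
  have hstep : ∀ t, ∫⁻ ω, g (ξ ω) t ∂μ + J (t + 1) ≤ J t := by
    intro t
    let Φ : (ℕ → net.Outcome) → net.Outcome → ℝ≥0∞ := fun b y => g b t *
      (growth (ENNReal.ofReal α) (ENNReal.ofReal ρ) (net.lenPath b t) *
        meanNext h (net.lenStep y.1 y.2.1 y.2.2 (net.lenPath b t)) y.1)
    have hΦ : ∀ b b' y, (∀ k ≤ t, b k = b' k) → Φ b y = Φ b' y := fun b b' y hb => by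
      simp only [Φ]
      rw [hg, growthPath_congr _ _ fun k hk => hb k hk.le, lenPath_congr hb]
    have hJ : J (t + 1) = ∫⁻ ω, Φ (ξ ω) (ξ ω (t + 1)) ∂μ := lintegral_congr fun ω => by
      simp only [Φ]
      rw [hg, growthPath, Finset.prod_range_succ, mul_assoc]
      rfl
    rw [hJ, hP.lintegral_next t Φ hΦ]
    have hmeas : Measurable fun ω => g (ξ ω) t :=
      (measurable_growthPath _ _ t).comp hP.measurable
    rw [← lintegral_add_left hmeas]
    refine lintegral_mono fun ω => ?_
    dsimp only
    refine le_trans (le_of_eq ?_) (mul_le_mul_right (one_add_growth_mul_sum_outcome_le hα hρ hh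
      hsup (net.lenPath (ξ ω) t) (ξ ω t).1) (g (ξ ω) t))
    rw [mul_add, mul_one]
    congr 1
    simp_rw [Finset.mul_sum]
    exact Finset.sum_congr rfl fun y _ => by ring
  have hsum : ∀ n, ∑ t ∈ Finset.range n, ∫⁻ ω, g (ξ ω) t ∂μ + J n ≤ J 0 := by
    intro n
    induction n with
    | zero => simp
    | succ n ih =>
      rw [Finset.sum_range_succ, add_assoc]
      exact (add_le_add le_rfl (hstep n)).trans ih
  have hJ₀ : J 0 < ⊤ := by
    have h₀ : J 0 = ∫⁻ ω, meanNext h (0, 0) (ξ ω 0).1 ∂μ := lintegral_congr fun ω => by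
      rw [hg, growthPath, Finset.prod_range_zero, one_mul]
      rfl
    rw [h₀]
    refine hP.lintegral_zero_lt_top (ENNReal.sum_lt_top.2 fun b _ => ?_)
    rcases (net.Q_nonneg m₀ b).eq_or_lt with hQ | hQ
    · simp [← hQ]
    · have := extendTop_eq h ⟨(0, 0, b), visited_zero hQ⟩
      refine ENNReal.mul_lt_top ENNReal.ofReal_lt_top ?_
      change extendTop h (net.lens (0, 0, b)) b < ⊤
      rw [this]
      exact ENNReal.ofReal_lt_top
  refine lt_of_le_of_lt ?_ hJ₀
  rw [ENNReal.tsum_eq_iSup_nat]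
  exact iSup_le fun n => le_self_add.trans (hsum n)

end Growth

end Network

/-! ### Stochastic stability -/

theorem theorem2
    -- the network; `(B, B', N)` starts in `m₀` and is irreducible and aperiodic
    (net : Network) (m₀ : net.Mode)
    (hirr : ChainIrreducible net.Q) (haper : ChainAperiodic net.Q)
    -- the plant, the control policy and the Lyapunov function
    {ls lu : ℕ}
    (f : EuclideanSpace ℝ (Fin ls) → EuclideanSpace ℝ (Fin lu) → EuclideanSpace ℝ (Fin ls))
    (κ : EuclideanSpace ℝ (Fin ls) → EuclideanSpace ℝ (Fin lu))
    (hf : Measurable (Function.uncurry f)) (hκ : Measurable κ)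
    (W : EuclideanSpace ℝ (Fin ls) → ℝ≥0) (ψ₁ ψ₂ : ℝ≥0 → ℝ≥0)
    (hψ₁ : IsClassKInf ψ₁) (hψ₂ : IsClassKInf ψ₂)
    (hW : ∀ x, ψ₁ ‖x‖₊ ≤ W x ∧ W x ≤ ψ₂ ‖x‖₊)
    (ρ : ℝ) (hρ₀ : 0 < ρ) (hρ₁ : ρ < 1)
    (hclosed : ∀ x, (W (f x (κ x)) : ℝ) ≤ ρ * W x)
    (α : ℝ) (hα : 0 < α)
    (hopen : ∀ x, (W (f x 0) : ℝ) ≤ α * W x)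
    -- the random network, and the random initial plant state, which is independent of it
    {Ω : Type*} [MeasurableSpace Ω] (μ : Measure Ω) [IsProbabilityMeasure μ]
    (m : ℕ → Ω → net.Mode) (γ γ' : ℕ → Ω → Bool)
    (hnet : net.IsNetworkProcess m₀ μ m γ γ')
    (x₀ : Ω → EuclideanSpace ℝ (Fin ls)) (hx₀ : Measurable x₀)
    (hindep : IndepFun x₀ (fun ω (t : ℕ) => (m t ω, γ t ω, γ' t ω)) μ)
    (hmoment : ∫⁻ ω, (ψ₂ ‖x₀ ω‖₊ : ℝ≥0∞) ∂μ < ⊤)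
    -- the stationary distribution of the embedded chain
    (π : net.OpenState m₀ → ℝ) (hπ : IsStationaryDist (net.Vtilde m₀) π) :
    -- `U` is nonnegative
    (∀ a b, 0 ≤ net.U m₀ ρ π a b) ∧
    -- stability if `(α / ρ) λ_max(U) < 1`
    (α / ρ * lambdaMax (net.U m₀ ρ π) < 1 →
      StochasticallyStable μ (fun t ω =>
        (closedLoop net f κ (fun k => m k ω) (fun k => γ k ω) (fun k => γ' k ω) (x₀ ω) t).x)) ∧
    -- the condition is not more restrictive than `(α / ρ) max r < 1`
    lambdaMax (net.U m₀ ρ π) ≤ ⨆ p : net.OpenState m₀ × net.OpenState m₀, net.r m₀ ρ p.1 p.2 := by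
  have hpos := Network.stationaryDist_pos hirr hπ
  obtain ⟨i₀, -, -⟩ := Finset.exists_ne_zero_of_sum_ne_zero
    (hπ.sum_eq_one.trans_ne one_ne_zero)
  have : Nonempty (net.OpenState m₀) := ⟨i₀⟩
  refine ⟨Network.U_nonneg hρ₀ hpos, fun hU => ⟨ψ₁, hψ₁, ?_⟩,
    Network.lambdaMax_U_le hρ₀ hpos hπ.stationary⟩
  obtain ⟨h, hh, hsup⟩ := Network.exists_supersolution_V hρ₀ hρ₁ hpos hα hU
  let ξ : Ω → ℕ → net.Outcome := fun ω t => (m t ω, γ t ω, γ' t ω)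
  have hP : net.IsNetworkProcess m₀ μ (fun t ω => (ξ ω t).1) (fun t ω => (ξ ω t).2.1)
      (fun t ω => (ξ ω t).2.2) := hnet
  have hψm : Measurable fun x : EuclideanSpace ℝ (Fin ls) => (ψ₂ ‖x‖₊ : ℝ≥0∞) :=
    (hψ₂.continuous.comp continuous_nnnorm).measurable.coe_nnreal_ennreal
  set g := net.growthPath (ENNReal.ofReal α) (ENNReal.ofReal ρ) with hg
  -- `W` need not be measurable, so that the bound is integrated with `ψ₂ |x₀|` in place of `W x₀`.
  have hbound : ∀ t ω, (ψ₁ ‖(closedLoop net f κ (fun k => m k ω) (fun k => γ k ω)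
      (fun k => γ' k ω) (x₀ ω) t).x‖₊ : ℝ≥0∞) ≤ g (ξ ω) t * ψ₂ ‖x₀ ω‖₊ := fun t ω =>
    (ENNReal.coe_le_coe.2 (hW _).1).trans ((lyapunov_closedLoop_le hclosed hopen (ξ ω)
      (x₀ ω) t).trans (mul_le_mul_right (ENNReal.coe_le_coe.2 (hW _).2) _))
  have hprod : ∀ t, ∫⁻ ω, g (ξ ω) t * ψ₂ ‖x₀ ω‖₊ ∂μ
      = (∫⁻ ω, g (ξ ω) t ∂μ) * ∫⁻ ω, (ψ₂ ‖x₀ ω‖₊ : ℝ≥0∞) ∂μ := fun t =>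
    lintegral_mul_eq_lintegral_mul_lintegral_of_indepFun
      ((Network.measurable_growthPath _ _ t).comp hP.measurable) (hψm.comp hx₀)
      (hindep.symm.comp (Network.measurable_growthPath _ _ t) hψm)
  refine (ENNReal.tsum_le_tsum fun t =>
    (lintegral_mono (hbound t)).trans (hprod t).le).trans_lt ?_
  rw [ENNReal.tsum_mul_right]
  exact ENNReal.mul_lt_top
    (hP.tsum_lintegral_growthPath_lt_top hα.le hρ₀.le hh hsup) hmoment
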